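/- **Setting.** Let $n\ge 1$, $k\ge 0$, and let $(M,HM,J)$ be an abstract CR manifold of type $(n,k)$: $M$ is a smooth Hausdorff, $\sigma$-compact manifold of real dimension $2n+k$, $HM\subset TM$ is a smooth subbundle of rank $2n$, $J$ is a smooth complex structure on the fibres of $HM$, and $T^{0,1}M=\{X+iJX : X\in HM\}$ is formally integrable: $[\Gamma(T^{0,1}M),\Gamma(T^{0,1}M)]\subset\Gamma(T^{0,1}M)$. Let $S\subset M$ be a polar submanifold: a closed embedded smooth submanifold of dimension $2(n-1)+k$ such that $HS=(TS\cap HM)\cap J(TS\cap HM)$ has constant rank $2(n-1)$ and $T_xS+H_xM=T_xM$ for all $x\in S$; put $T^{0,1}S=\{X+iJX: X\in HS\}$. Let $\mathcal E^p(U)$ be the space of smooth complex valued $p$-forms on the open set $U$ ($\mathcal E^{-1}=0$), let $\mathcal I$ be the ideal of forms whose restriction to $T^{0,1}$ vanishes, and let $\mathcal I^p$ be its $p$-th exterior power. A CR form of degree $p$ is a smooth $p$-form $\alpha\in\mathcal I^p$ with $d\alpha\in\mathcal I^{p+1}$. For a smooth function $s$, the condition $\bar\partial_M s=0$ at $x$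 means that $ds$ vanishes on $T^{0,1}_xM$. Restriction $|_S$ means pullback to $S$. For $\phi\in\mathcal E^p(M\setminus S)$, call a pair $(U,s)$ *admissible* if $U\subset M$ is open, $s:U\to\mathbb C$ is smooth, $S\cap U=\{x\in U: s(x)=0\}$, $ds\neq0$ everywhere in $U$, $\bar\partial_Ms=0$ on $S\cap U$, and $s\phi$ extends smoothly from $U\setminus S$ to $U$. The form $\phi$ has a *pole of (at most) the first order along $S$* if every point of $S$ lies in $U$ for some admissible pair $(U,s)$. **Theorem 4.1.** Let $\phi\in\mathcal E^p(M\setminus S)$, $p\ge 0$, be closed on $M\setminus S$ with a first order pole along $S$. 1. For every admissible pair $(U,s)$ there are $\psi\in\mathcal E^{p-1}(U)$ and $\theta\in\mathcal E^p(U)$ such that $$\phi=\frac{ds}{s}\wedge\psi+\theta\qquad\text{in }U\setminus S.$$ (For $p=0$ this says that $\phi=\theta$ extends smoothly to $U$; the statements below concern $p\ge1$.) 2. For every such $(U,s,\psi,\theta)$ the form $\psi|_S$ is smooth and closed on $S\cap U$. It depends only on $\phi$ and $S$: if $(U',s',\psi',\theta')$ is another choice of an admissible pair and of a decomposition, then $\psi|_S=\psi'|_S$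 on $S\cap U\cap U'$. Hence there is exactly one form $\operatorname{res}[\phi]$ of degree $p-1$ on $S$ with $\operatorname{res}[\phi]=\psi|_S$ on $S\cap U$ for all such $(U,s,\psi,\theta)$, and it is smooth and closed on $S$. 3. If $\phi$ is a CR form on $M\setminus S$, then $\psi|_S$ is a CR form of degree $p-1$ on $S\cap U$ (for the CR structure $(HS,J|_{HS})$ of $S$) for every such $(U,s,\psi,\theta)$; hence $\operatorname{res}[\phi]$ is a CR form on $S$. -/

import Mathlib

open Set Manifold
open scoped ContDiff Topology

noncomputable section

/-! ### Complex valued differential forms on smooth manifolds -/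

/-- The model space of a smooth real manifold of dimension `m`. -/
abbrev RModel (m : ℕ) : Type := EuclideanSpace ℝ (Fin m)

/-- (Not necessarily smooth) complex valued differential forms of degree `p` on a smooth manifold
of real dimension `m`: at each point a real multilinear alternating complex valued map. -/
abbrev DForm (m : ℕ) (M : Type*) [TopologicalSpace M] [ChartedSpace (RModel m) M] (p : ℕ) : Type _ :=
  ∀ x : M, TangentSpace 𝓘(ℝ, RModel m) x [⋀^Fin p]→L[ℝ] ℂ

namespace DForm

section
variable {m : ℕ} {M : Type*} [TopologicalSpace M] [ChartedSpace (RModel m) M] {p : ℕ}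

/-- The coordinate expression of a form in the preferred chart at `x₀`: its pullback under the
inverse of that chart. Only its values on the target of the chart are meaningful. -/
def inChart (η : DForm m M p) (x₀ : M) : RModel m → RModel m [⋀^Fin p]→L[ℝ] ℂ := fun y =>
  (η ((chartAt (RModel m) x₀).symm y)).compContinuousLinearMap
    (mfderiv 𝓘(ℝ, RModel m) 𝓘(ℝ, RModel m) (chartAt (RModel m) x₀).symm y)

/-- `η` is a smooth form on the (open) set `U`: its coordinate expressions are smooth. -/
def SmoothOn (η : DForm m M p) (U : Set M) : Prop :=
  ∀ x₀ : M, ContDiffOn ℝ ∞ (η.inChart x₀)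
    ((chartAt (RModel m) x₀).target ∩ (chartAt (RModel m) x₀).symm ⁻¹' U)

/-- The exterior derivative, computed at `x` in the preferred chart at `x`. -/
def d (η : DForm m M p) : DForm m M (p + 1) := fun x =>
  (extDeriv (η.inChart x) (chartAt (RModel m) x x)).compContinuousLinearMap
    (mfderiv 𝓘(ℝ, RModel m) 𝓘(ℝ, RModel m) (chartAt (RModel m) x) x)

end

section
variable {m m' : ℕ} {M N : Type*} [TopologicalSpace M] [ChartedSpace (RModel m) M]
  [TopologicalSpace N] [ChartedSpace (RModel m') N] {p : ℕ}

/-- The pullback of a form by a map. -/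
def pullback (f : N → M) (η : DForm m M p) : DForm m' N p := fun y =>
  (η (f y)).compContinuousLinearMap (mfderiv 𝓘(ℝ, RModel m') 𝓘(ℝ, RModel m) f y)

end

end DForm

/-- The differential at `x` of a complex valued function `s`. -/
def dfun {m : ℕ} {M : Type*} [TopologicalSpace M] [ChartedSpace (RModel m) M]
    (s : M → ℂ) (x : M) : TangentSpace 𝓘(ℝ, RModel m) x →L[ℝ] ℂ :=
  mfderiv 𝓘(ℝ, RModel m) 𝓘(ℝ, ℂ) s x

/-- The form `ds ∧ ψ`, for a complex valued function `s` and a form `ψ` of degree `p`: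
`(ds ∧ ψ)(v₀,…,v_p) = ∑ i, (-1)^i ds(v_i) ψ(v₀,…,v̂_i,…,v_p)`. -/
def DForm.dfunWedge {m : ℕ} {M : Type*} [TopologicalSpace M] [ChartedSpace (RModel m) M] {p : ℕ}
    (s : M → ℂ) (ψ : DForm m M p) : DForm m M (p + 1) := fun x =>
  let α : RModel m →L[ℝ] ℂ := dfun s x
  let β : RModel m [⋀^Fin p]→L[ℝ] ℂ := ψ x
  ContinuousAlternatingMap.alternatizeUncurryFin (α.smulRight β)

/-! ### The ideal of a subspace of complex tangent vectors, and its powers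

A complex tangent vector `X + iY` (with `X`, `Y` in the real vector space `E`) is the
pair `(X, Y)`. -/

section
variable {E : Type*} [AddCommGroup E] [Module ℝ E]

/-- The exterior product of alternating forms of degrees `a` and `b` (sum over shuffles). -/
def altWedge {a b : ℕ} (α : E [⋀^Fin a]→ₗ[ℝ] ℂ) (β : E [⋀^Fin b]→ₗ[ℝ] ℂ) :
    E [⋀^Fin (a + b)]→ₗ[ℝ] ℂ :=
  ((LinearMap.mul' ℝ ℂ).compAlternatingMap (α.domCoprod β)).domDomCongr finSumFinEquiv

/-- The value on the complex vectors `X_j + i Y_j` of the complex multilinear extension of `α`. -/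
def complexEval {m : ℕ} (α : E [⋀^Fin m]→ₗ[ℝ] ℂ) (Z : Fin m → E × E) : ℂ :=
  ∑ t : Finset (Fin m),
    Complex.I ^ t.card * α (fun j => if j ∈ t then (Z j).2 else (Z j).1)

/-- The degree `m` part of the ideal of forms whose restriction to `T` vanishes. -/
def vanishingForms (T : Set (E × E)) (m : ℕ) : Set (E [⋀^Fin m]→ₗ[ℝ] ℂ) :=
  {α | ∀ Z : Fin m → E × E, (∀ j, Z j ∈ T) → complexEval α Z = 0}

/-- The degree `m` part of the `p`-th exterior power `I^p = I^(p-1) ∧ I` of the ideal `I` of forms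
whose restriction to `T` vanishes; `I^0` is the whole exterior algebra. -/
def idealPow (T : Set (E × E)) : ℕ → (m : ℕ) → Submodule ℂ (E [⋀^Fin m]→ₗ[ℝ] ℂ)
  | 0, _ => ⊤
  | p + 1, m => Submodule.span ℂ
      {η | ∃ (a b : ℕ) (h : a + b = m), ∃ α ∈ idealPow T p a, ∃ β ∈ vanishingForms T b,
        η = (altWedge α β).domDomCongr (finCongr h)}

end

/-! ### CR manifolds -/

/-- A vector field (a section of the tangent bundle) is smooth on the set `U`. -/
def SmoothFieldOn {m : ℕ} {M : Type*} [TopologicalSpace M] [ChartedSpace (RModel m) M]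
    [IsManifold 𝓘(ℝ, RModel m) ∞ M] (X : ∀ x : M, TangentSpace 𝓘(ℝ, RModel m) x) (U : Set M) : Prop :=
  ContMDiffOn 𝓘(ℝ, RModel m) 𝓘(ℝ, RModel m).tangent ∞
    (fun x => (⟨x, X x⟩ : TangentBundle 𝓘(ℝ, RModel m) M)) U

/-- An abstract CR structure of type `(n, k)` on a smooth manifold of dimension `2n + k`. -/
structure CRStructure (n k : ℕ) (M : Type*) [TopologicalSpace M]
    [ChartedSpace (RModel (2 * n + k)) M] [IsManifold 𝓘(ℝ, RModel (2 * n + k)) ∞ M] where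
  /-- The Levi distribution. -/
  H : ∀ x : M, Submodule ℝ (TangentSpace 𝓘(ℝ, RModel (2 * n + k)) x)
  /-- The complex structure on the fibres of the Levi distribution. -/
  J : ∀ x : M, H x →ₗ[ℝ] H x
  J_sq : ∀ (x : M) (v : H x), J x (J x v) = -v
  rank : ∀ x : M, Module.finrank ℝ (H x) = 2 * n
  /-- `H` is a smooth subbundle and `J` is smooth: near every point there is a smooth local frame
  of `H` that `J` maps to smooth vector fields. -/
  smooth : ∀ x₀ : M, ∃ U : Set M, IsOpen U ∧ x₀ ∈ U ∧ ∃ X : Fin (2 * n) → ∀ x : M, H x,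
    (∀ x ∈ U, Submodule.span ℝ (range fun i => X i x) = ⊤) ∧
    (∀ i, SmoothFieldOn (fun x => (X i x : TangentSpace 𝓘(ℝ, RModel (2 * n + k)) x)) U) ∧
    ∀ i, SmoothFieldOn (fun x => (J x (X i x) : TangentSpace 𝓘(ℝ, RModel (2 * n + k)) x)) U
  /-- Formal integrability: the bracket of the smooth sections `X + iJX` and `Y + iJY` of `T^{0,1}M`
  is again of the form `W + iJW` with `W` in `H`. -/
  integrable : ∀ X Y : ∀ x : M, H x,
    SmoothFieldOn (fun x => (X x : TangentSpace 𝓘(ℝ, RModel (2 * n + k)) x)) univ →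
    SmoothFieldOn (fun x => (Y x : TangentSpace 𝓘(ℝ, RModel (2 * n + k)) x)) univ →
    ∀ x : M, ∃ W : H x,
      (W : TangentSpace 𝓘(ℝ, RModel (2 * n + k)) x) =
        VectorField.mlieBracket 𝓘(ℝ, RModel (2 * n + k)) (fun y => X y) (fun y => Y y) x -
        VectorField.mlieBracket 𝓘(ℝ, RModel (2 * n + k))
          (fun y => J y (X y)) (fun y => J y (Y y)) x ∧
      (J x W : TangentSpace 𝓘(ℝ, RModel (2 * n + k)) x) =
        VectorField.mlieBracket 𝓘(ℝ, RModel (2 * n + k)) (fun y => X y) (fun y => J y (Y y)) x +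
        VectorField.mlieBracket 𝓘(ℝ, RModel (2 * n + k)) (fun y => J y (X y)) (fun y => Y y) x

/-- `φ` is, on the open set `U`, a CR form of degree `p` with respect to the family `T` of spaces
of complex tangent vectors of type `(0,1)`: it is smooth and lies in `I^p`, and the class of `dφ`
modulo `I^(p+1)` vanishes. -/
def IsCRFormOn {m : ℕ} {M : Type*} [TopologicalSpace M] [ChartedSpace (RModel m) M] {p : ℕ}
    (T : ∀ x : M, Set (TangentSpace 𝓘(ℝ, RModel m) x × TangentSpace 𝓘(ℝ, RModel m) x))
    (φ : DForm m M p) (U : Set M) : Prop :=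
  φ.SmoothOn U ∧
  ∀ x ∈ U, (φ x).toAlternatingMap ∈ idealPow (T x) p p ∧
    (φ.d x).toAlternatingMap ∈ idealPow (T x) (p + 1) (p + 1)

namespace CRStructure

section
variable {n k : ℕ} {M : Type*} [TopologicalSpace M]
  [ChartedSpace (RModel (2 * n + k)) M] [IsManifold 𝓘(ℝ, RModel (2 * n + k)) ∞ M]

/-- The fibre of `T^{0,1}M`: the complex tangent vectors `X + iJX` with `X` in `H`. -/
def T01 (cr : CRStructure n k M) (x : M) :
    Set (TangentSpace 𝓘(ℝ, RModel (2 * n + k)) x × TangentSpace 𝓘(ℝ, RModel (2 * n + k)) x) :=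
  {Z | ∃ X : cr.H x, Z = (↑X, ↑(cr.J x X))}

/-- `∂̄_M s = 0` at the point `x`: the differential of `s` vanishes on `T^{0,1}_x M`. -/
def DbarZeroAt (cr : CRStructure n k M) (s : M → ℂ) (x : M) : Prop :=
  ∀ Z ∈ cr.T01 x, dfun s x Z.1 + Complex.I * dfun s x Z.2 = 0

end

section
variable {n k : ℕ} {M N : Type*} [TopologicalSpace M]
  [ChartedSpace (RModel (2 * (n + 1) + k)) M] [IsManifold 𝓘(ℝ, RModel (2 * (n + 1) + k)) ∞ M]
  [TopologicalSpace N] [ChartedSpace (RModel (2 * n + k)) N]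

/-- The tangent space of the submanifold `ι : N → M` at `ι y`, as a subspace of that of `M`. -/
def tangentImage (ι : N → M) (y : N) :
    Submodule ℝ (TangentSpace 𝓘(ℝ, RModel (2 * (n + 1) + k)) (ι y)) :=
  LinearMap.range
    (mfderiv 𝓘(ℝ, RModel (2 * n + k)) 𝓘(ℝ, RModel (2 * (n + 1) + k)) ι y).toLinearMap

/-- `HS = (TS ∩ HM) ∩ J(TS ∩ HM)` for the submanifold `S` given by `ι : N → M`. -/
def inducedH (cr : CRStructure (n + 1) k M) (ι : N → M) (y : N) :
    Submodule ℝ (TangentSpace 𝓘(ℝ, RModel (2 * (n + 1) + k)) (ι y)) :=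
  (((tangentImage ι y).comap (cr.H (ι y)).subtype) ⊓
    ((tangentImage ι y).comap (cr.H (ι y)).subtype).map (cr.J (ι y))).map (cr.H (ι y)).subtype

/-- `T^{0,1}S` for the induced CR structure `(HS, J)`: the complex tangent vectors `X + iY` of `S`
with `X` in `HS` and `Y = JX`. -/
def inducedT01 (cr : CRStructure (n + 1) k M) (ι : N → M) (y : N) :
    Set (TangentSpace 𝓘(ℝ, RModel (2 * n + k)) y × TangentSpace 𝓘(ℝ, RModel (2 * n + k)) y) :=
  {Z | ∃ h : cr.H (ι y), (h : TangentSpace 𝓘(ℝ, RModel (2 * (n + 1) + k)) (ι y)) ∈ inducedH cr ι y ∧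
    mfderiv 𝓘(ℝ, RModel (2 * n + k)) 𝓘(ℝ, RModel (2 * (n + 1) + k)) ι y Z.1 = h ∧
    mfderiv 𝓘(ℝ, RModel (2 * n + k)) 𝓘(ℝ, RModel (2 * (n + 1) + k)) ι y Z.2 = cr.J (ι y) h}

/-- The smooth map `ι : N → M` is the inclusion of a polar submanifold: a closed embedded
submanifold which is a CR submanifold of type `(n, k)` of the CR manifold `M` of type `(n + 1, k)`,
and is transversal to the Levi distribution. -/
structure IsPolar (cr : CRStructure (n + 1) k M) (ι : N → M) : Prop where
  embedding : IsSmoothEmbedding 𝓘(ℝ, RModel (2 * n + k)) 𝓘(ℝ, RModel (2 * (n + 1) + k)) ∞ ι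
  closed : IsClosed (range ι)
  rank : ∀ y : N, Module.finrank ℝ (inducedH cr ι y) = 2 * n
  transversal : ∀ y : N, tangentImage ι y ⊔ cr.H (ι y) = ⊤

/-- `s` is a smooth local defining function in the open set `U` for the submanifold `S` given
by `ι`, with `ds ≠ 0` in `U` and `∂̄_M s = 0` on `S ∩ U`, and `s φ` extends smoothly to `U`.
Only the values of `φ` off `S` matter. -/
structure IsPoleChart (cr : CRStructure (n + 1) k M) (ι : N → M) {p : ℕ}
    (φ : DForm (2 * (n + 1) + k) M p) (U : Set M) (s : M → ℂ) : Prop where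
  isOpen : IsOpen U
  smooth : ContMDiffOn 𝓘(ℝ, RModel (2 * (n + 1) + k)) 𝓘(ℝ, ℂ) ∞ s U
  zero_iff : ∀ x ∈ U, s x = 0 ↔ x ∈ range ι
  differential_ne_zero : ∀ x ∈ U,
    (dfun s x : TangentSpace 𝓘(ℝ, RModel (2 * (n + 1) + k)) x →L[ℝ] ℂ) ≠ 0
  dbar_zero : ∀ x ∈ U ∩ range ι, cr.DbarZeroAt s x
  smooth_extension : ∃ η : DForm (2 * (n + 1) + k) M p, η.SmoothOn U ∧
    ∀ x ∈ U \ range ι, η x = s x • φ x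

/-- `φ` has a pole of (at most) the first order along `S`. -/
def HasFirstOrderPole (cr : CRStructure (n + 1) k M) (ι : N → M) {p : ℕ}
    (φ : DForm (2 * (n + 1) + k) M p) : Prop :=
  ∀ y : N, ∃ (U : Set M) (s : M → ℂ), ι y ∈ U ∧ cr.IsPoleChart ι φ U s

/-- `φ = (ds / s) ∧ ψ + θ` on `U \ S`, with `ψ` and `θ` smooth on `U`. -/
def IsDecomposition (ι : N → M) {p : ℕ} (φ : DForm (2 * (n + 1) + k) M (p + 1))
    (U : Set M) (s : M → ℂ) (ψ : DForm (2 * (n + 1) + k) M p)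
    (θ : DForm (2 * (n + 1) + k) M (p + 1)) : Prop :=
  ψ.SmoothOn U ∧ θ.SmoothOn U ∧
  ∀ x ∈ U \ range ι, φ x = (s x)⁻¹ • DForm.dfunWedge s ψ x + θ x

/-- `r` is the residue form of `φ`: it is equal to `ψ|_S` on `S ∩ U`, for every admissible local
defining function `s` in `U` and every decomposition `φ = (ds / s) ∧ ψ + θ` in `U`. -/
def IsResidueForm (cr : CRStructure (n + 1) k M) (ι : N → M) {p : ℕ}
    (φ : DForm (2 * (n + 1) + k) M (p + 1)) (r : DForm (2 * n + k) N p) : Prop :=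
  ∀ (U : Set M) (s : M → ℂ) (ψ : DForm (2 * (n + 1) + k) M p)
    (θ : DForm (2 * (n + 1) + k) M (p + 1)),
    cr.IsPoleChart ι φ U s → IsDecomposition ι φ U s ψ θ →
    ∀ y ∈ ι ⁻¹' U, r y = DForm.pullback ι ψ y

end

end CRStructure

end

noncomputable section

/-! ### Smoothness of alternating-map valued functions -/

section FormSmoothness

variable {E F : Type*} [NormedAddCommGroup E] [NormedSpace ℝ E]
  [NormedAddCommGroup F] [NormedSpace ℝ F] {p : ℕ}

/-! Decomposition. Let `η` be the smooth extension of `s φ`. Off `S`, closedness of `φ` gives `dη =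
ds ∧ φ`. Choose a smooth complex vector field `Z` with `ds(Z) = 1`, which is possible because `ds ≠
0`. Since contraction is an antiderivation, `φ = ι_Z(ds ∧ φ) + ds ∧ ι_Z φ = ι_Z dη + (ds/s) ∧ ι_Z
η`. Hence `ψ = ι_Z η` and `θ = ι_Z dη` work and are smooth across `S`. The field `Z` is built in
each chart and the results are glued by a partition of unity (`contract_oneWedge`,
`local_decomposition`, `exists_decomposition`). In degree zero only `ι_Z dη` remains.

Closedness and uniqueness. Differentiating `s φ = ds ∧ ψ + s θ` yields `ds ∧ dψ = s dθ` off `S`,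
hence `ds ∧ dψ = 0` on `S` by continuity. Moreover `s φ` tends to `ds ∧ ψ` at points of `S`, and for
a second defining function `s'/s` tends to `ds'(v)/ds(v)` along a line in a direction `v`
transversal for both. So `ds ∧ ψ` and `ds' ∧ ψ'` are proportional with a known factor. As `ds`
vanishes on `TS`, evaluating such identities on one transversal vector and otherwise on vectors of
`TS` turns them into statements about `ψ|_S` (`dfunWedge_d_eq_zero`, `smul_dfunWedge_eq`,
`dfunWedge_cons`).

CR forms. In degree `p`, membership in `I^p` means being annihilated by contraction with every
vector of `T^{0,1}` (`cons_add_I_mul_cons_of_mem_idealPow` and `mem_idealPow_of_annihilated`). This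
condition passes from `φ` to `s φ`, and in the limit to `ds ∧ ψ` on `S`. For a `(0,1)` vector
tangent to `S`, which `ds` kills, it passes on to `ψ|_S`. The condition on `d(ψ|_S)` is automatic,
because this form is zero. -/

theorem finiteDimensional_continuousAlternatingMap [FiniteDimensional ℝ E] :
    FiniteDimensional ℝ (E [⋀^Fin p]→L[ℝ] ℂ) := by
  let Φ : (E [⋀^Fin p]→L[ℝ] ℂ) →ₗ[ℝ] MultilinearMap ℝ (fun _ : Fin p => E) ℂ :=
    { toFun := fun f => f.toContinuousMultilinearMap.toMultilinearMap
      map_add' := fun _ _ => rfl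
      map_smul' := fun _ _ => rfl }
  refine Module.Finite.of_injective Φ fun f g h => ?_
  ext v
  exact congrArg (fun k : MultilinearMap ℝ (fun _ : Fin p => E) ℂ => k v) h

/-- Evaluation on tuples of basis vectors embeds the forms linearly into a finite power of `ℂ`; a
linear left inverse recovers the form from these values. -/
theorem contDiffAt_form_of_apply [FiniteDimensional ℝ E] {n : WithTop ℕ∞} {ζ : F → E [⋀^Fin p]→L[ℝ] ℂ} {x : F}
    (h : ∀ v, ContDiffAt ℝ n (fun y => ζ y v) x) : ContDiffAt ℝ n ζ x := by
  have : FiniteDimensional ℝ (E [⋀^Fin p]→L[ℝ] ℂ) := finiteDimensional_continuousAlternatingMap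
  let b := Module.finBasis ℝ E
  let Φ : (E [⋀^Fin p]→L[ℝ] ℂ) →ₗ[ℝ] ((Fin p → Fin (Module.finrank ℝ E)) → ℂ) :=
    { toFun := fun f k => f fun i => b (k i)
      map_add' := fun _ _ => rfl
      map_smul' := fun _ _ => rfl }
  have hΦ : LinearMap.ker Φ = ⊥ := by
    refine LinearMap.ker_eq_bot.2 fun f g h => ?_
    apply ContinuousAlternatingMap.toContinuousMultilinearMap_injective
    apply ContinuousMultilinearMap.toMultilinearMap_injective
    exact Module.Basis.ext_multilinear (fun _ => b) fun k => congrFun h k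
  obtain ⟨L, hL⟩ := Φ.exists_leftInverse_of_injective hΦ
  have e : ζ = fun y => L.toContinuousLinearMap (Φ (ζ y)) := by
    funext y
    exact (LinearMap.congr_fun hL (ζ y)).symm
  rw [e]
  exact (L.toContinuousLinearMap.contDiff.contDiffAt).comp x
    (contDiffAt_pi.2 fun k => h fun i => b (k i))

theorem ContDiffAt.form_apply_const {n : WithTop ℕ∞} {ζ : F → E [⋀^Fin p]→L[ℝ] ℂ} {x : F}
    (h : ContDiffAt ℝ n ζ x) (v : Fin p → E) : ContDiffAt ℝ n (fun y => ζ y v) x :=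
  ((ContinuousAlternatingMap.apply ℝ E ℂ v).contDiff.contDiffAt).comp x h

/-- Multilinear expansion in a basis reduces moving arguments to constant ones, with polynomial
coefficients in the coordinates of the arguments. -/
theorem ContDiffAt.form_apply [FiniteDimensional ℝ E] {n : WithTop ℕ∞} {ζ : F → E [⋀^Fin p]→L[ℝ] ℂ} {x : F}
    (h : ContDiffAt ℝ n ζ x) {w : Fin p → F → E} (hw : ∀ i, ContDiffAt ℝ n (w i) x) :
    ContDiffAt ℝ n (fun y => ζ y fun i => w i y) x := by
  let b := Module.finBasis ℝ E
  have e : (fun y => ζ y fun i => w i y) = fun y => ∑ k : Fin p → Fin (Module.finrank ℝ E),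
      (∏ i, b.repr (w i y) (k i)) • ζ y fun i => b (k i) := by
    funext y
    conv_lhs =>
      enter [2, i]
      rw [← b.sum_repr (w i y)]
    have := (ζ y).toContinuousMultilinearMap.toMultilinearMap.map_sum
      (fun i j => b.repr (w i y) j • b j)
    refine this.trans (Finset.sum_congr rfl fun k _ => ?_)
    exact (ζ y).toContinuousMultilinearMap.toMultilinearMap.map_smul_univ _ _
  rw [e]
  refine ContDiffAt.sum fun k _ => ?_
  suffices hk : ContDiffAt ℝ n (fun y => ∏ i, b.repr (w i y) (k i)) x from
    hk.smul (h.form_apply_const fun i => b (k i))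
  refine contDiffAt_prod fun i _ => ?_
  exact ((LinearMap.toContinuousLinearMap (b.coord (k i))).contDiff.contDiffAt).comp x (hw i)

theorem ContDiffAt.form_comp [FiniteDimensional ℝ E] {n : WithTop ℕ∞} {E' : Type*} [NormedAddCommGroup E']
    [NormedSpace ℝ E'] [FiniteDimensional ℝ E'] {ζ : F → E [⋀^Fin p]→L[ℝ] ℂ} {x : F}
    (h : ContDiffAt ℝ n ζ x) {D : F → E' →L[ℝ] E} (hD : ContDiffAt ℝ n D x) :
    ContDiffAt ℝ n (fun y => (ζ y).compContinuousLinearMap (D y)) x :=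
  contDiffAt_form_of_apply fun _ => h.form_apply fun _ => hD.clm_apply contDiffAt_const

end FormSmoothness

/-! ### Wedge product with a linear form, and contraction -/

section Wedge

variable {E : Type*} [NormedAddCommGroup E] [NormedSpace ℝ E] {p : ℕ}

/-- The wedge product of a complex valued real linear form and an alternating form. -/
def oneWedge (α : E →L[ℝ] ℂ) (β : E [⋀^Fin p]→L[ℝ] ℂ) : E [⋀^Fin (p + 1)]→L[ℝ] ℂ :=
  ContinuousAlternatingMap.alternatizeUncurryFin (α.smulRight β)

theorem oneWedge_apply (α : E →L[ℝ] ℂ) (β : E [⋀^Fin p]→L[ℝ] ℂ) (v : Fin (p + 1) → E) :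
    oneWedge α β v = ∑ i : Fin (p + 1), (-1) ^ (i : ℕ) * (α (v i) * β (i.removeNth v)) := by
  rw [oneWedge, ContinuousAlternatingMap.alternatizeUncurryFin_apply]
  refine Finset.sum_congr rfl fun i _ => ?_
  simp [zsmul_eq_mul]

theorem oneWedge_comp {E' : Type*} [NormedAddCommGroup E'] [NormedSpace ℝ E'] (α : E →L[ℝ] ℂ)
    (β : E [⋀^Fin p]→L[ℝ] ℂ) (D : E' →L[ℝ] E) :
    (oneWedge α β).compContinuousLinearMap D =
      oneWedge (α.comp D) (β.compContinuousLinearMap D) := by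
  ext v
  simp only [ContinuousAlternatingMap.compContinuousLinearMap_apply, oneWedge_apply]
  rfl

theorem oneWedge_add (α : E →L[ℝ] ℂ) (β γ : E [⋀^Fin p]→L[ℝ] ℂ) :
    oneWedge α (β + γ) = oneWedge α β + oneWedge α γ := by
  ext v
  simp [oneWedge_apply, mul_add, Finset.sum_add_distrib]

theorem oneWedge_smul (α : E →L[ℝ] ℂ) (c : ℂ) (β : E [⋀^Fin p]→L[ℝ] ℂ) :
    oneWedge α (c • β) = c • oneWedge α β := by
  ext v
  simp only [oneWedge_apply, ContinuousAlternatingMap.smul_apply, smul_eq_mul, Finset.mul_sum]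
  exact Finset.sum_congr rfl fun i _ => by ring

theorem oneWedge_zero (α : E →L[ℝ] ℂ) : oneWedge α (0 : E [⋀^Fin p]→L[ℝ] ℂ) = 0 := by
  ext v
  simp [oneWedge_apply]

theorem oneWedge_sum {ι : Type*} (s : Finset ι) (α : E →L[ℝ] ℂ) (β : ι → E [⋀^Fin p]→L[ℝ] ℂ) :
    oneWedge α (∑ i ∈ s, β i) = ∑ i ∈ s, oneWedge α (β i) := by
  classical
  induction s using Finset.induction_on with
  | empty => simp [oneWedge_zero]
  | insert a s ha ih => rw [Finset.sum_insert ha, Finset.sum_insert ha, oneWedge_add, ih]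

/-- All terms but the first feed some `w i` to `α`. This extracts `β` on the kernel of `α` from the
wedge product. -/
theorem oneWedge_cons (α : E →L[ℝ] ℂ) (β : E [⋀^Fin p]→L[ℝ] ℂ) (v : E) (w : Fin p → E)
    (hw : ∀ i, α (w i) = 0) : oneWedge α β (Fin.cons v w) = α v * β w := by
  rw [oneWedge_apply, Fin.sum_univ_succ]
  simp [hw]

/-- Contraction is an antiderivation: the term feeding `v` to `α` splits off, and in the others `v`
stays in front of `β` while the sign shifts by one place. -/
theorem curryLeft_oneWedge (α : E →L[ℝ] ℂ) (β : E [⋀^Fin (p + 1)]→L[ℝ] ℂ) (v : E) :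
    (oneWedge α β).curryLeft v = α v • β - oneWedge α (β.curryLeft v) := by
  ext w
  have h : (oneWedge α β).curryLeft v w = oneWedge α β (Fin.cons v w) := rfl
  rw [h, oneWedge_apply, Fin.sum_univ_succ, ContinuousAlternatingMap.sub_apply, oneWedge_apply,
    sub_eq_add_neg, ← Finset.sum_neg_distrib]
  congr 1
  · simp
  · refine Finset.sum_congr rfl fun i _ => ?_
    have h2 : (i.succ.removeNth (Fin.cons v w : Fin (p + 2) → E)) =
        (Fin.cons v (i.removeNth w) : Fin (p + 1) → E) := by
      funext j
      refine Fin.cases ?_ (fun j => ?_) j <;> simp [Fin.removeNth]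
    rw [h2]
    have h3 : β.curryLeft v (i.removeNth w) = β (Fin.cons v (i.removeNth w)) := rfl
    rw [h3]
    simp [pow_succ]

theorem curryLeft_oneWedge_zero (α : E →L[ℝ] ℂ) (β : E [⋀^Fin 0]→L[ℝ] ℂ) (v : E) :
    (oneWedge α β).curryLeft v = α v • β := by
  ext w
  have h : (oneWedge α β).curryLeft v w = oneWedge α β (Fin.cons v w) := rfl
  rw [h, oneWedge_cons _ _ _ _ fun i => i.elim0]
  rfl

theorem ContinuousAlternatingMap.ext_curryLeft {β γ : E [⋀^Fin (p + 1)]→L[ℝ] ℂ}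
    (h : ∀ v, β.curryLeft v = γ.curryLeft v) : β = γ := by
  ext w
  rw [← Fin.cons_self_tail w]
  exact congrArg (fun δ : E [⋀^Fin p]→L[ℝ] ℂ => δ (Fin.tail w)) (h (w 0))

/-- Induction on the degree by contracting: the two terms with `α v` cancel, and what is left is the
same expression with `β` contracted. -/
theorem oneWedge_oneWedge (α : E →L[ℝ] ℂ) (β : E [⋀^Fin p]→L[ℝ] ℂ) :
    oneWedge α (oneWedge α β) = 0 := by
  induction p with
  | zero =>
    refine ContinuousAlternatingMap.ext_curryLeft fun v => ?_
    rw [curryLeft_oneWedge, curryLeft_oneWedge_zero, oneWedge_smul, sub_self]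
    rfl
  | succ p ih =>
    refine ContinuousAlternatingMap.ext_curryLeft fun v => ?_
    have h : oneWedge α (α v • β - oneWedge α (β.curryLeft v)) = α v • oneWedge α β := by
      rw [sub_eq_add_neg, ← neg_one_smul ℂ (oneWedge α (β.curryLeft v)), oneWedge_add,
        oneWedge_smul, oneWedge_smul, ih]
      ext w
      simp
    rw [curryLeft_oneWedge, curryLeft_oneWedge, h, sub_self]
    rfl

variable {m : ℕ}

/-- Contraction with the complex vector with coefficients `c` in the family `b`. -/
def contract (b : Fin m → E) (c : Fin m → ℂ) (β : E [⋀^Fin (p + 1)]→L[ℝ] ℂ) :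
    E [⋀^Fin p]→L[ℝ] ℂ :=
  ∑ j, c j • β.curryLeft (b j)

/-- The identity `ι_Z(α ∧ β) + α ∧ ι_Z β = α(Z) β` for the complex vector `Z = ∑ c_j b_j`,
normalized by `α(Z) = 1`. It is the algebraic source of the decomposition. -/
theorem contract_oneWedge (b : Fin m → E) (c : Fin m → ℂ) (α : E →L[ℝ] ℂ)
    (h : ∑ j, c j * α (b j) = 1) (β : E [⋀^Fin (p + 1)]→L[ℝ] ℂ) :
    contract b c (oneWedge α β) = β - oneWedge α (contract b c β) := by
  simp only [contract, curryLeft_oneWedge, oneWedge_sum, smul_sub, Finset.sum_sub_distrib,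
    oneWedge_smul, smul_smul, ← Finset.sum_smul, h, one_smul]

theorem contract_oneWedge_zero (b : Fin m → E) (c : Fin m → ℂ) (α : E →L[ℝ] ℂ)
    (h : ∑ j, c j * α (b j) = 1) (β : E [⋀^Fin 0]→L[ℝ] ℂ) :
    contract b c (oneWedge α β) = β := by
  simp only [contract, curryLeft_oneWedge_zero, smul_smul, ← Finset.sum_smul, h, one_smul]

theorem contract_smul (b : Fin m → E) (c : Fin m → ℂ) (a : ℂ) (β : E [⋀^Fin (p + 1)]→L[ℝ] ℂ) :
    contract b c (a • β) = a • contract b c β := by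
  ext v
  simp only [contract, ContinuousAlternatingMap.sum_apply, ContinuousAlternatingMap.smul_apply,
    smul_eq_mul, Finset.mul_sum]
  refine Finset.sum_congr rfl fun i _ => ?_
  have h (γ : E [⋀^Fin (p + 1)]→L[ℝ] ℂ) : γ.curryLeft (b i) v = γ (Fin.cons (b i) v) := rfl
  rw [h, h, ContinuousAlternatingMap.smul_apply, smul_eq_mul]
  ring

/-- The decomposition of a form with a pole along the zero set of a function with differential `α`
and value `z ≠ 0`. -/
theorem decomposition_of_wedge_eq (b : Fin m → E) (c : Fin m → ℂ) (α : E →L[ℝ] ℂ)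
    (h : ∑ j, c j * α (b j) = 1) {z : ℂ} (hz : z ≠ 0) {φ : E [⋀^Fin (p + 1)]→L[ℝ] ℂ}
    {η : E [⋀^Fin (p + 1)]→L[ℝ] ℂ} {dη : E [⋀^Fin (p + 2)]→L[ℝ] ℂ} (hη : η = z • φ)
    (hdη : dη = oneWedge α φ) :
    φ = z⁻¹ • oneWedge α (contract b c η) + contract b c dη := by
  rw [hη, hdη, contract_oneWedge b c α h, contract_smul, oneWedge_smul, smul_smul,
    inv_mul_cancel₀ hz, one_smul]
  abel

theorem ContDiffAt.curryLeft [FiniteDimensional ℝ E] {F : Type*} [NormedAddCommGroup F]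
    [NormedSpace ℝ F] {n : WithTop ℕ∞}
    {ζ : F → E [⋀^Fin (p + 1)]→L[ℝ] ℂ} {x : F} (h : ContDiffAt ℝ n ζ x) (v : E) :
    ContDiffAt ℝ n (fun y => (ζ y).curryLeft v) x :=
  contDiffAt_form_of_apply fun w => h.form_apply_const (Fin.cons v w)

theorem ContDiffAt.contract [FiniteDimensional ℝ E] {F : Type*} [NormedAddCommGroup F]
    [NormedSpace ℝ F] {n : WithTop ℕ∞} {ζ : F → E [⋀^Fin (p + 1)]→L[ℝ] ℂ} {x : F}
    (h : ContDiffAt ℝ n ζ x) (b : Fin m → E) {c : F → Fin m → ℂ} (hc : ContDiffAt ℝ n c x) :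
    ContDiffAt ℝ n (fun y => _root_.contract b (c y) (ζ y)) x :=
  ContDiffAt.sum fun j _ => ContDiffAt.smul (contDiffAt_pi.1 hc j) (h.curryLeft (b j))

theorem ContDiffAt.oneWedge [FiniteDimensional ℝ E] {F : Type*} [NormedAddCommGroup F]
    [NormedSpace ℝ F] {n : WithTop ℕ∞} {ζ : F → E [⋀^Fin p]→L[ℝ] ℂ} {x : F}
    (h : ContDiffAt ℝ n ζ x) {α : F → E →L[ℝ] ℂ} (hα : ContDiffAt ℝ n α x) :
    ContDiffAt ℝ n (fun y => _root_.oneWedge (α y) (ζ y)) x :=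
  contDiffAt_form_of_apply fun v => by
    simp only [oneWedge_apply]
    exact ContDiffAt.sum fun i _ => contDiffAt_const.mul
      ((hα.clm_apply contDiffAt_const).mul (h.form_apply_const _))

theorem extDeriv_fun_smul_form {f : E → ℂ} {ζ : E → E [⋀^Fin p]→L[ℝ] ℂ} {x : E}
    (hf : DifferentiableAt ℝ f x) (hζ : DifferentiableAt ℝ ζ x) :
    extDeriv (fun y => f y • ζ y) x = oneWedge (fderiv ℝ f x) (ζ x) + f x • extDeriv ζ x := by
  have h := fderiv_smul hf hζ
  have e : (fun y => f y • ζ y) = f • ζ := rfl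
  rw [e, extDeriv, h, ContinuousAlternatingMap.alternatizeUncurryFin_add,
    ContinuousAlternatingMap.alternatizeUncurryFin_smul]
  exact add_comm _ _

end Wedge

/-- The order of smoothness needed for symmetry of second derivatives, hence for `d ∘ d = 0` and for
`d` to commute with pullback. -/
theorem two_le_infty : (2 : WithTop ℕ∞) ≤ ∞ :=
  WithTop.coe_le_coe.2 (OrderTop.le_top (2 : ℕ∞))

/-! ### Differential forms in charts: pullback, exterior derivative and independence of the chart.
-/

section Charts

variable {m : ℕ} {M : Type*} [TopologicalSpace M] [ChartedSpace (RModel m) M]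
  [IsManifold 𝓘(ℝ, RModel m) ∞ M]
  {m' : ℕ} {N : Type*} [TopologicalSpace N] [ChartedSpace (RModel m') N]
  [IsManifold 𝓘(ℝ, RModel m') ∞ N] {p : ℕ}

theorem mdifferentiable_chartAt (x₀ : M) :
    (chartAt (RModel m) x₀).MDifferentiable 𝓘(ℝ, RModel m) 𝓘(ℝ, RModel m) :=
  have : IsManifold 𝓘(ℝ, RModel m) 1 M := .of_le (n := ∞) (by simp)
  mdifferentiable_chart x₀

theorem mdifferentiableAt_chartAt {x₀ x : M} (hx : x ∈ (chartAt (RModel m) x₀).source) :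
    MDifferentiableAt 𝓘(ℝ, RModel m) 𝓘(ℝ, RModel m) (chartAt (RModel m) x₀) x :=
  (mdifferentiable_chartAt x₀).mdifferentiableAt hx

theorem mdifferentiableAt_chartAt_symm {x₀ : M} {y : RModel m}
    (hy : y ∈ (chartAt (RModel m) x₀).target) :
    MDifferentiableAt 𝓘(ℝ, RModel m) 𝓘(ℝ, RModel m) (chartAt (RModel m) x₀).symm y :=
  (mdifferentiable_chartAt x₀).mdifferentiableAt_symm hy

/-- The differential of a complex valued function, as a form on the model space. -/
def modelDfun (s : M → ℂ) (x : M) : RModel m →L[ℝ] ℂ := dfun s x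

/-- The differential of a map between manifolds, as a map between the model spaces. -/
def modelDeriv (f : N → M) (y : N) : RModel m' →L[ℝ] RModel m :=
  mfderiv 𝓘(ℝ, RModel m') 𝓘(ℝ, RModel m) f y

/-- The pullback of an alternating form by a linear map between the model spaces. -/
def formPull (β : RModel m [⋀^Fin p]→L[ℝ] ℂ) (D : RModel m' →L[ℝ] RModel m) :
    RModel m' [⋀^Fin p]→L[ℝ] ℂ :=
  β.compContinuousLinearMap D

/-- The coordinate expression of a map in the preferred charts. -/
def coordMap (f : N → M) (y₀ : N) (x₀ : M) : RModel m' → RModel m :=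
  fun z => chartAt (RModel m) x₀ (f ((chartAt (RModel m') y₀).symm z))

theorem coordMap_chartAt (f : N → M) {y₀ y : N} (x₀ : M)
    (hy : y ∈ (chartAt (RModel m') y₀).source) :
    coordMap f y₀ x₀ (chartAt (RModel m') y₀ y) = chartAt (RModel m) x₀ (f y) := by
  rw [coordMap, (chartAt (RModel m') y₀).left_inv hy]

theorem fderiv_coordMap {f : N → M} {y₀ y : N} {x₀ : M} {z : RModel m'}
    (hz : z ∈ (chartAt (RModel m') y₀).target) (hzy : (chartAt (RModel m') y₀).symm z = y)
    (hfy : f y ∈ (chartAt (RModel m) x₀).source)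
    (hf : MDifferentiableAt 𝓘(ℝ, RModel m') 𝓘(ℝ, RModel m) f y) :
    fderiv ℝ (coordMap f y₀ x₀) z = (modelDeriv (chartAt (RModel m) x₀) (f y) :
      RModel m →L[ℝ] RModel m).comp
      ((modelDeriv f y : RModel m' →L[ℝ] RModel m).comp (modelDeriv (chartAt (RModel m') y₀).symm z)) := by
  subst hzy
  rw [← mfderiv_eq_fderiv]
  have h1 := mdifferentiableAt_chartAt_symm hz
  have h2 := mdifferentiableAt_chartAt hfy
  have h3 : MDifferentiableAt 𝓘(ℝ, RModel m') 𝓘(ℝ, RModel m)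
    (f ∘ (chartAt (RModel m') y₀).symm) z := hf.comp z h1
  have h4 := mfderiv_comp z h2 h3
  rw [mfderiv_comp z hf h1] at h4
  exact h4

theorem mfderiv_chartAt_symm_mfderiv_chartAt {x₀ x : M}
    (hx : x ∈ (chartAt (RModel m) x₀).source) (v : RModel m) :
    mfderiv 𝓘(ℝ, RModel m) 𝓘(ℝ, RModel m) (chartAt (RModel m) x₀).symm (chartAt (RModel m) x₀ x)
      (mfderiv 𝓘(ℝ, RModel m) 𝓘(ℝ, RModel m) (chartAt (RModel m) x₀) x v) = v :=
  congrArg (fun A : RModel m →L[ℝ] RModel m => A v)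
    ((mdifferentiable_chartAt x₀).symm_comp_deriv hx)

theorem modelDeriv_chartAt_modelDeriv_symm {x₀ x : M} {y : RModel m}
    (hy : y ∈ (chartAt (RModel m) x₀).target) (h : (chartAt (RModel m) x₀).symm y = x)
    (v : RModel m) :
    (modelDeriv (chartAt (RModel m) x₀) x : RModel m →L[ℝ] RModel m)
      (modelDeriv (chartAt (RModel m) x₀).symm y v) = v := by
  subst h
  exact congrArg (fun A : RModel m →L[ℝ] RModel m => A v)
    ((mdifferentiable_chartAt x₀).comp_symm_deriv hy)

theorem contDiffAt_coordMap {f : N → M} (hf : ContMDiff 𝓘(ℝ, RModel m') 𝓘(ℝ, RModel m) ∞ f)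
    {y₀ y : N} {x₀ : M} (hy : y ∈ (chartAt (RModel m') y₀).source)
    (hfy : f y ∈ (chartAt (RModel m) x₀).source) :
    ContDiffAt ℝ ∞ (coordMap f y₀ x₀ : RModel m' → RModel m) (chartAt (RModel m') y₀ y) := by
  rw [← contMDiffAt_iff_contDiffAt]
  have h1 : ContMDiffAt 𝓘(ℝ, RModel m') 𝓘(ℝ, RModel m') ∞ (chartAt (RModel m') y₀).symm
      (chartAt (RModel m') y₀ y) :=
    (contMDiffOn_chart_symm (I := 𝓘(ℝ, RModel m')) (x := y₀)).contMDiffAt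
      ((chartAt (RModel m') y₀).open_target.mem_nhds ((chartAt (RModel m') y₀).map_source hy))
  have hl := (chartAt (RModel m') y₀).left_inv hy
  have h2 : ContMDiffAt 𝓘(ℝ, RModel m) 𝓘(ℝ, RModel m) ∞ (chartAt (RModel m) x₀) (f y) :=
    (contMDiffOn_chart (I := 𝓘(ℝ, RModel m)) (x := x₀)).contMDiffAt
      ((chartAt (RModel m) x₀).open_source.mem_nhds hfy)
  have h3 : ContMDiffAt 𝓘(ℝ, RModel m') 𝓘(ℝ, RModel m) ∞
      (f ∘ (chartAt (RModel m') y₀).symm) (chartAt (RModel m') y₀ y) :=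
    ContMDiffAt.comp _ hf.contMDiffAt h1
  refine ContMDiffAt.comp (chartAt (RModel m') y₀ y) (g := chartAt (RModel m) x₀)
    (f := f ∘ (chartAt (RModel m') y₀).symm) ?_ h3
  simpa [hl] using h2

namespace DForm

theorem inChart_of_symm_eq (η : DForm m M p) {x₀ x : M} {y : RModel m}
    (h : (chartAt (RModel m) x₀).symm y = x) :
    η.inChart x₀ y = formPull (η x)
      (modelDeriv (chartAt (RModel m) x₀).symm y) := by
  subst h
  rfl

/-- A form is recovered from its coordinate expression. -/
theorem inChart_comp_mfderiv (η : DForm m M p) {x₀ x : M}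
    (hx : x ∈ (chartAt (RModel m) x₀).source) :
    formPull
      (η.inChart x₀ (chartAt (RModel m) x₀ x))
      (modelDeriv (chartAt (RModel m) x₀) x) = η x := by
  rw [inChart_of_symm_eq η ((chartAt (RModel m) x₀).left_inv hx)]
  ext v
  refine congrArg (η x) ?_
  funext i
  exact mfderiv_chartAt_symm_mfderiv_chartAt hx (v i)

/-- By the chain rule, pullback on manifolds becomes pullback by `coordMap` between open sets of the
model spaces, where the calculus of `extDeriv` applies. -/
theorem inChart_pullback {f : N → M} (η : DForm m M p) {y₀ : N} (x₀ : M) {z : RModel m'}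
    (hz : z ∈ (chartAt (RModel m') y₀).target)
    (hfz : f ((chartAt (RModel m') y₀).symm z) ∈ (chartAt (RModel m) x₀).source)
    (hf : MDifferentiableAt 𝓘(ℝ, RModel m') 𝓘(ℝ, RModel m) f ((chartAt (RModel m') y₀).symm z)) :
    inChart (pullback f η : DForm m' N p) y₀ z =
      (η.inChart x₀ (coordMap f y₀ x₀ z)).compContinuousLinearMap
        (fderiv ℝ (coordMap f y₀ x₀) z) := by
  rw [fderiv_coordMap hz rfl hfz hf, inChart, pullback, ← inChart_comp_mfderiv η hfz]
  rfl

theorem pullback_id (η : DForm m M p) : pullback (m' := m) (id : M → M) η = η := by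
  funext x
  ext v
  simp [pullback]

theorem eventually_inChart_pullback {f : N → M} (hf : ContMDiff 𝓘(ℝ, RModel m') 𝓘(ℝ, RModel m) ∞ f)
    (η : DForm m M p) {y₀ y : N} {x₀ : M} (hy : y ∈ (chartAt (RModel m') y₀).source)
    (hfy : f y ∈ (chartAt (RModel m) x₀).source) :
    ∀ᶠ z in 𝓝 (chartAt (RModel m') y₀ y), inChart (pullback f η : DForm m' N p) y₀ z =
      (η.inChart x₀ (coordMap f y₀ x₀ z)).compContinuousLinearMap
        (fderiv ℝ (coordMap f y₀ x₀) z) := by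
  have h1 := (chartAt (RModel m') y₀).open_target.mem_nhds ((chartAt (RModel m') y₀).map_source hy)
  have h2 : ContinuousAt (f ∘ (chartAt (RModel m') y₀).symm) (chartAt (RModel m') y₀ y) := by
    refine ContinuousAt.comp hf.continuous.continuousAt ?_
    exact (chartAt (RModel m') y₀).continuousAt_symm ((chartAt (RModel m') y₀).map_source hy)
  have h3 : (chartAt (RModel m) x₀).source ∈
      𝓝 ((f ∘ (chartAt (RModel m') y₀).symm) (chartAt (RModel m') y₀ y)) := by
    rw [Function.comp_apply, (chartAt (RModel m') y₀).left_inv hy]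
    exact (chartAt (RModel m) x₀).open_source.mem_nhds hfy
  filter_upwards [h1, h2 h3] with z hz hfz
  exact inChart_pullback η x₀ hz hfz (hf.mdifferentiable (by simp) _)

theorem contDiffAt_inChart_pullback {f : N → M}
    (hf : ContMDiff 𝓘(ℝ, RModel m') 𝓘(ℝ, RModel m) ∞ f)
    (η : DForm m M p) {y₀ y : N} {x₀ : M} (hy : y ∈ (chartAt (RModel m') y₀).source)
    (hfy : f y ∈ (chartAt (RModel m) x₀).source)
    (hη : ContDiffAt ℝ ∞ (η.inChart x₀) (chartAt (RModel m) x₀ (f y))) :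
    ContDiffAt ℝ ∞ (inChart (pullback f η : DForm m' N p) y₀) (chartAt (RModel m') y₀ y) := by
  refine ContDiffAt.congr_of_eventuallyEq ?_ (eventually_inChart_pullback hf η hy hfy)
  have hF := contDiffAt_coordMap hf hy hfy
  refine ContDiffAt.form_comp (ContDiffAt.comp (g := η.inChart x₀) _ ?_ hF) (hF.fderiv_right (by simp))
  rwa [coordMap_chartAt f x₀ hy]

/-- A change of charts is the coordinate expression of the identity map, so this is the pullback
statement for `id`. -/
theorem contDiffAt_inChart_change (η : DForm m M p) {x₀ x₁ x : M}
    (h₁ : x ∈ (chartAt (RModel m) x₁).source) (h₀ : x ∈ (chartAt (RModel m) x₀).source)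
    (hη : ContDiffAt ℝ ∞ (η.inChart x₀) (chartAt (RModel m) x₀ x)) :
    ContDiffAt ℝ ∞ (η.inChart x₁) (chartAt (RModel m) x₁ x) := by
  have := contDiffAt_inChart_pullback (f := (id : M → M)) contMDiff_id η h₁ h₀ hη
  rwa [pullback_id] at this

/-- Smoothness of a form near a point. -/
def SmoothNear (η : DForm m M p) (x : M) : Prop :=
  ContDiffAt ℝ ∞ (η.inChart x) (chartAt (RModel m) x x)

theorem SmoothNear.contDiffAt {η : DForm m M p} {x : M} (h : η.SmoothNear x) {x₀ : M}
    (hx : x ∈ (chartAt (RModel m) x₀).source) :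
    ContDiffAt ℝ ∞ (η.inChart x₀) (chartAt (RModel m) x₀ x) :=
  contDiffAt_inChart_change η hx (mem_chart_source _ x) h

theorem isOpen_inChart_preimage (x₀ : M) {U : Set M} (hU : IsOpen U) :
    IsOpen ((chartAt (RModel m) x₀).target ∩ (chartAt (RModel m) x₀).symm ⁻¹' U) :=
  (chartAt (RModel m) x₀).isOpen_inter_preimage_symm hU

theorem smoothOn_iff {η : DForm m M p} {U : Set M} (hU : IsOpen U) :
    η.SmoothOn U ↔ ∀ x ∈ U, η.SmoothNear x := by
  constructor
  · intro h x hx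
    refine (h x).contDiffAt ((isOpen_inChart_preimage x hU).mem_nhds ⟨mem_chart_target _ x, ?_⟩)
    rwa [mem_preimage, (chartAt (RModel m) x).left_inv (mem_chart_source _ x)]
  · rintro h x₀ y ⟨hy, hyU⟩
    have := (h _ hyU).contDiffAt (x₀ := x₀) ((chartAt (RModel m) x₀).map_target hy)
    rw [(chartAt (RModel m) x₀).right_inv hy] at this
    exact this.contDiffWithinAt

theorem SmoothNear.pullback {f : N → M} (hf : ContMDiff 𝓘(ℝ, RModel m') 𝓘(ℝ, RModel m) ∞ f)
    {η : DForm m M p} {y : N} (h : η.SmoothNear (f y)) :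
    (DForm.pullback f η : DForm m' N p).SmoothNear y :=
  contDiffAt_inChart_pullback hf η (mem_chart_source _ y) (mem_chart_source _ (f y)) h

theorem extDeriv_inChart_pullback {f : N → M}
    (hf : ContMDiff 𝓘(ℝ, RModel m') 𝓘(ℝ, RModel m) ∞ f)
    {η : DForm m M p} {y₀ y : N} {x₀ : M} (hy : y ∈ (chartAt (RModel m') y₀).source)
    (hfy : f y ∈ (chartAt (RModel m) x₀).source) (hη : η.SmoothNear (f y)) :
    extDeriv (inChart (DForm.pullback f η : DForm m' N p) y₀) (chartAt (RModel m') y₀ y) =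
      (extDeriv (η.inChart x₀) (chartAt (RModel m) x₀ (f y))).compContinuousLinearMap
        (fderiv ℝ (coordMap f y₀ x₀) (chartAt (RModel m') y₀ y)) := by
  rw [Filter.EventuallyEq.extDeriv_eq (eventually_inChart_pullback hf η hy hfy), extDeriv_pullback (r := ∞) ?_
    (contDiffAt_coordMap hf hy hfy) (by simpa using two_le_infty), coordMap_chartAt f x₀ hy]
  rw [coordMap_chartAt f x₀ hy]
  exact (hη.contDiffAt hfy).differentiableAt (by simp)

/-- The definition of `d` uses a different chart at each point. Naturality of `extDeriv`, applied to
the identity map, shows that any chart around the point gives the same result. -/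
theorem d_eq_inChart {η : DForm m M p} {x₀ x : M} (hx : x ∈ (chartAt (RModel m) x₀).source)
    (hη : η.SmoothNear x) :
    η.d x = formPull
      (extDeriv (η.inChart x₀) (chartAt (RModel m) x₀ x))
      (modelDeriv (chartAt (RModel m) x₀) x) := by
  have h := extDeriv_inChart_pullback (f := (id : M → M)) (η := η) contMDiff_id
    (mem_chart_source (RModel m) x) hx hη
  rw [pullback_id] at h
  rw [d, h, fderiv_coordMap (mem_chart_target _ x)
    ((chartAt (RModel m) x).left_inv (mem_chart_source _ x)) hx mdifferentiableAt_id,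
    show modelDeriv (id : M → M) x = ContinuousLinearMap.id ℝ (RModel m) from mfderiv_id]
  ext v
  refine congrArg (extDeriv (η.inChart x₀) (chartAt (RModel m) x₀ x)) ?_
  funext i
  have hc := mfderiv_chartAt_symm_mfderiv_chartAt (mem_chart_source _ x) (v i)
  exact congrArg (modelDeriv (chartAt (RModel m) x₀) x) hc

theorem d_pullback {f : N → M} (hf : ContMDiff 𝓘(ℝ, RModel m') 𝓘(ℝ, RModel m) ∞ f)
    {η : DForm m M p} {y : N} (hη : η.SmoothNear (f y)) :
    (DForm.pullback f η : DForm m' N p).d y = (η.d (f y)).compContinuousLinearMap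
      (mfderiv 𝓘(ℝ, RModel m') 𝓘(ℝ, RModel m) f y) := by
  have h := extDeriv_inChart_pullback hf (mem_chart_source (RModel m') y)
    (mem_chart_source (RModel m) (f y)) hη
  rw [d, h, fderiv_coordMap (mem_chart_target _ y)
    ((chartAt (RModel m') y).left_inv (mem_chart_source _ y)) (mem_chart_source _ (f y))
    (hf.mdifferentiable (by simp) _)]
  ext v
  refine congrArg (extDeriv (η.inChart (f y)) (chartAt (RModel m) (f y) (f y))) ?_
  funext i
  have hc := mfderiv_chartAt_symm_mfderiv_chartAt (mem_chart_source _ y) (v i)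
  exact congrArg (fun w => modelDeriv (chartAt (RModel m) (f y)) (f y)
    (mfderiv 𝓘(ℝ, RModel m') 𝓘(ℝ, RModel m) f y w)) hc

theorem SmoothNear.d_inChart {η : DForm m M p} {x₀ x : M}
    (hx : x ∈ (chartAt (RModel m) x₀).source) (hη : η.SmoothNear x) :
    η.d.inChart x₀ (chartAt (RModel m) x₀ x) =
      extDeriv (η.inChart x₀) (chartAt (RModel m) x₀ x) := by
  rw [inChart_of_symm_eq _ ((chartAt (RModel m) x₀).left_inv hx), d_eq_inChart hx hη]
  ext v
  refine congrArg (extDeriv (η.inChart x₀) (chartAt (RModel m) x₀ x)) ?_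
  funext i
  exact modelDeriv_chartAt_modelDeriv_symm ((chartAt (RModel m) x₀).map_source hx)
    ((chartAt (RModel m) x₀).left_inv hx) (v i)

/-- The form with a given expression in a chart. -/
def ofChart (x₀ : M) (ζ : RModel m → RModel m [⋀^Fin p]→L[ℝ] ℂ) : DForm m M p := fun x =>
  formPull (ζ (chartAt (RModel m) x₀ x)) (modelDeriv (chartAt (RModel m) x₀) x)

theorem inChart_ofChart (x₀ : M) (ζ : RModel m → RModel m [⋀^Fin p]→L[ℝ] ℂ) {y : RModel m}
    (hy : y ∈ (chartAt (RModel m) x₀).target) : (ofChart x₀ ζ).inChart x₀ y = ζ y := by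
  rw [inChart, ofChart, (chartAt (RModel m) x₀).right_inv hy]
  ext v
  refine congrArg (ζ y) ?_
  funext i
  exact modelDeriv_chartAt_modelDeriv_symm hy rfl (v i)

theorem smoothNear_ofChart {x₀ x : M} (hx : x ∈ (chartAt (RModel m) x₀).source)
    {ζ : RModel m → RModel m [⋀^Fin p]→L[ℝ] ℂ}
    (h : ContDiffAt ℝ ∞ ζ (chartAt (RModel m) x₀ x)) : (ofChart x₀ ζ).SmoothNear x := by
  refine contDiffAt_inChart_change _ (mem_chart_source _ x) hx (h.congr_of_eventuallyEq ?_)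
  filter_upwards [(chartAt (RModel m) x₀).open_target.mem_nhds
    ((chartAt (RModel m) x₀).map_source hx)] with y hy
  exact inChart_ofChart x₀ ζ hy

/-- Forms that agree in a chart are equal. -/
theorem eq_of_inChart_eq {η ζ : DForm m M p} {x₀ x : M} (hx : x ∈ (chartAt (RModel m) x₀).source)
    (h : η.inChart x₀ (chartAt (RModel m) x₀ x) = ζ.inChart x₀ (chartAt (RModel m) x₀ x)) :
    η x = ζ x := by
  rw [← inChart_comp_mfderiv η hx, ← inChart_comp_mfderiv ζ hx, h]

theorem inChart_eventuallyEq {η ζ : DForm m M p} {x : M} (h : ∀ᶠ x' in 𝓝 x, η x' = ζ x') (x₀ : M)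
    (hx : x ∈ (chartAt (RModel m) x₀).source) :
    η.inChart x₀ =ᶠ[𝓝 (chartAt (RModel m) x₀ x)] ζ.inChart x₀ := by
  have hc := (chartAt (RModel m) x₀).continuousAt_symm ((chartAt (RModel m) x₀).map_source hx)
  rw [ContinuousAt, (chartAt (RModel m) x₀).left_inv hx] at hc
  filter_upwards [hc h] with y hy
  have hy' : η ((chartAt (RModel m) x₀).symm y) = ζ ((chartAt (RModel m) x₀).symm y) := hy
  rw [inChart, inChart, hy']

theorem SmoothNear.congr {η ζ : DForm m M p} {x : M} (h : η.SmoothNear x)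
    (he : ∀ᶠ x' in 𝓝 x, ζ x' = η x') : ζ.SmoothNear x :=
  ContDiffAt.congr_of_eventuallyEq h (inChart_eventuallyEq he x (mem_chart_source _ x))

theorem d_congr {η ζ : DForm m M p} {x : M} (he : ∀ᶠ x' in 𝓝 x, ζ x' = η x') : ζ.d x = η.d x := by
  rw [d, d, (inChart_eventuallyEq he x (mem_chart_source _ x)).extDeriv_eq]

theorem inChart_add (η ζ : DForm m M p) (x₀ : M) (y : RModel m) :
    (η + ζ).inChart x₀ y = η.inChart x₀ y + ζ.inChart x₀ y := rfl

theorem inChart_smul (f : M → ℂ) (η : DForm m M p) (x₀ : M) (y : RModel m) :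
    inChart (fun x => f x • η x : DForm m M p) x₀ y =
      f ((chartAt (RModel m) x₀).symm y) • η.inChart x₀ y := rfl

theorem smoothNear_zero (x : M) : (0 : DForm m M p).SmoothNear x := by
  have h : (0 : DForm m M p).inChart x = fun _ => 0 := rfl
  rw [SmoothNear, h]
  exact contDiffAt_const

theorem SmoothNear.add {η ζ : DForm m M p} {x : M} (hη : η.SmoothNear x) (hζ : ζ.SmoothNear x) :
    (η + ζ).SmoothNear x :=
  ContDiffAt.add hη hζ

theorem SmoothNear.sum {ι : Type*} {s : Finset ι} {η : ι → DForm m M p} {x : M}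
    (h : ∀ i ∈ s, (η i).SmoothNear x) : (∑ i ∈ s, η i).SmoothNear x := by
  classical
  induction s using Finset.induction_on with
  | empty => exact smoothNear_zero x
  | insert a s ha ih =>
    rw [Finset.sum_insert ha]
    exact (h a (Finset.mem_insert_self a s)).add (ih fun i hi => h i (Finset.mem_insert_of_mem hi))

/-- The coordinate expression of a function. -/
abbrev _root_.coordFun (s : M → ℂ) (x₀ : M) : RModel m → ℂ := s ∘ (chartAt (RModel m) x₀).symm

theorem _root_.ContMDiffAt.coordFun {s : M → ℂ} {x x₀ : M}
    (hs : ContMDiffAt 𝓘(ℝ, RModel m) 𝓘(ℝ, ℂ) ∞ s x) (hx : x ∈ (chartAt (RModel m) x₀).source) :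
    ContDiffAt ℝ ∞ (coordFun s x₀ : RModel m → ℂ) (chartAt (RModel m) x₀ x) := by
  rw [← contMDiffAt_iff_contDiffAt]
  have h1 : ContMDiffAt 𝓘(ℝ, RModel m) 𝓘(ℝ, RModel m) ∞ (chartAt (RModel m) x₀).symm
      (chartAt (RModel m) x₀ x) :=
    (contMDiffOn_chart_symm (I := 𝓘(ℝ, RModel m)) (x := x₀)).contMDiffAt
      ((chartAt (RModel m) x₀).open_target.mem_nhds ((chartAt (RModel m) x₀).map_source hx))
  refine ContMDiffAt.comp (chartAt (RModel m) x₀ x) ?_ h1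
  rwa [(chartAt (RModel m) x₀).left_inv hx]

theorem SmoothNear.smul {f : M → ℂ} {η : DForm m M p} {x : M}
    (hf : ContMDiffAt 𝓘(ℝ, RModel m) 𝓘(ℝ, ℂ) ∞ f x) (hη : η.SmoothNear x) :
    SmoothNear (fun x => f x • η x : DForm m M p) x :=
  ContDiffAt.smul (hf.coordFun (mem_chart_source _ x)) hη

theorem _root_.fderiv_coordFun {s : M → ℂ} {x x₀ : M} {y : RModel m}
    (hs : MDifferentiableAt 𝓘(ℝ, RModel m) 𝓘(ℝ, ℂ) s x)
    (hy : y ∈ (chartAt (RModel m) x₀).target) (h : (chartAt (RModel m) x₀).symm y = x) :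
    fderiv ℝ (coordFun s x₀ : RModel m → ℂ) y =
      (modelDfun s x : RModel m →L[ℝ] ℂ).comp (modelDeriv (chartAt (RModel m) x₀).symm y) := by
  subst h
  rw [← mfderiv_eq_fderiv]
  exact mfderiv_comp y hs (mdifferentiableAt_chartAt_symm hy)

theorem inChart_dfunWedge {s : M → ℂ} {x x₀ : M} (ψ : DForm m M p)
    (hs : MDifferentiableAt 𝓘(ℝ, RModel m) 𝓘(ℝ, ℂ) s x)
    (hx : x ∈ (chartAt (RModel m) x₀).source) :
    (dfunWedge s ψ).inChart x₀ (chartAt (RModel m) x₀ x) =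
      oneWedge (fderiv ℝ (coordFun s x₀ : RModel m → ℂ) (chartAt (RModel m) x₀ x))
        (ψ.inChart x₀ (chartAt (RModel m) x₀ x)) := by
  rw [fderiv_coordFun hs ((chartAt (RModel m) x₀).map_source hx)
      ((chartAt (RModel m) x₀).left_inv hx), inChart_of_symm_eq _ ((chartAt (RModel m) x₀).left_inv hx),
    inChart_of_symm_eq _ ((chartAt (RModel m) x₀).left_inv hx)]
  exact oneWedge_comp _ _ _

end DForm

end Charts

/-! ### Existence of the decomposition: contraction in charts and gluing. -/

section Local

variable {m : ℕ} {M : Type*} [TopologicalSpace M] [ChartedSpace (RModel m) M]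
  [IsManifold 𝓘(ℝ, RModel m) ∞ M] {p : ℕ}

namespace DForm

theorem d_smul {f : M → ℂ} {η : DForm m M p} {x : M}
    (hf : ContMDiffAt 𝓘(ℝ, RModel m) 𝓘(ℝ, ℂ) ∞ f x) (hη : η.SmoothNear x) :
    d (fun x => f x • η x : DForm m M p) x = dfunWedge f η x + f x • η.d x := by
  have hx := mem_chart_source (RModel m) x
  refine eq_of_inChart_eq (η := d (fun x => f x • η x : DForm m M p))
    (ζ := dfunWedge f η + fun x => f x • η.d x) hx ?_
  rw [(SmoothNear.smul hf hη).d_inChart hx, inChart_add, inChart_smul,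
    inChart_dfunWedge η (hf.mdifferentiableAt (by simp)) hx, hη.d_inChart hx]
  exact extDeriv_fun_smul_form ((hf.coordFun hx).differentiableAt (by simp))
    (hη.differentiableAt (by simp))

end DForm

/-- Coefficients of a complex vector on which a nonzero linear form takes the value one. -/
def dualCoeff (α : RModel m →L[ℝ] ℂ) (j : Fin m) : ℂ :=
  (∑ k, starRingEnd ℂ (α (EuclideanSpace.basisFun (Fin m) ℝ k)) *
    α (EuclideanSpace.basisFun (Fin m) ℝ k))⁻¹ *
    starRingEnd ℂ (α (EuclideanSpace.basisFun (Fin m) ℝ j))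

/-- The sum is `∑ |α(e_k)|²`, which vanishes only if `α` vanishes on a basis. -/
theorem sum_conj_mul_ne_zero {α : RModel m →L[ℝ] ℂ} (h : α ≠ 0) :
    ∑ k, starRingEnd ℂ (α (EuclideanSpace.basisFun (Fin m) ℝ k)) *
      α (EuclideanSpace.basisFun (Fin m) ℝ k) ≠ 0 := by
  intro h0
  apply h
  have h1 : ∑ k, Complex.normSq (α (EuclideanSpace.basisFun (Fin m) ℝ k)) = 0 := by
    have : ((∑ k, Complex.normSq (α (EuclideanSpace.basisFun (Fin m) ℝ k)) : ℝ) : ℂ) = 0 := by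
      rw [← h0]
      push_cast
      exact Finset.sum_congr rfl fun k _ => Complex.normSq_eq_conj_mul_self
    exact_mod_cast this
  rw [Finset.sum_eq_zero_iff_of_nonneg fun k _ => Complex.normSq_nonneg _] at h1
  have h2 : (α : RModel m →ₗ[ℝ] ℂ) = 0 :=
    (EuclideanSpace.basisFun (Fin m) ℝ).toBasis.ext fun k => by
      simpa using h1 k (Finset.mem_univ k)
  ext v
  exact LinearMap.congr_fun h2 v

theorem sum_dualCoeff_mul {α : RModel m →L[ℝ] ℂ} (h : α ≠ 0) :
    ∑ j, dualCoeff α j * α (EuclideanSpace.basisFun (Fin m) ℝ j) = 1 := by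
  simp only [dualCoeff, mul_assoc, ← Finset.mul_sum]
  exact inv_mul_cancel₀ (sum_conj_mul_ne_zero h)

theorem ContDiffAt.dualCoeff {α : RModel m → RModel m →L[ℝ] ℂ} {x : RModel m}
    (hα : ContDiffAt ℝ ∞ α x) (h : α x ≠ 0) :
    ContDiffAt ℝ ∞ (fun y => _root_.dualCoeff (α y)) x := by
  have h1 (v : RModel m) : ContDiffAt ℝ ∞ (fun y => α y v) x := hα.clm_apply contDiffAt_const
  have h2 (v : RModel m) : ContDiffAt ℝ ∞ (fun y => starRingEnd ℂ (α y v)) x :=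
    (Complex.conjCLE.contDiff.contDiffAt).comp x (h1 v)
  refine contDiffAt_pi.2 fun j => ContDiffAt.mul (ContDiffAt.inv ?_ (sum_conj_mul_ne_zero h)) (h2 _)
  exact ContDiffAt.sum fun k _ => (h2 _).mul (h1 _)

theorem ContDiffAt.extDeriv {ζ : RModel m → RModel m [⋀^Fin p]→L[ℝ] ℂ} {x : RModel m}
    (h : ContDiffAt ℝ ∞ ζ x) : ContDiffAt ℝ ∞ (_root_.extDeriv ζ) x :=
  ((ContinuousAlternatingMap.alternatizeUncurryFinCLM ℝ (RModel m) ℂ).contDiff.contDiffAt).comp x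
    (h.fderiv_right (by simp))

/-- The contraction of `η` with a complex vector field on which `ds = 1`, in a chart. -/
def chartContract (s : M → ℂ) (x₀ : M) (ζ : RModel m → RModel m [⋀^Fin (p + 1)]→L[ℝ] ℂ) :
    DForm m M p :=
  DForm.ofChart x₀ fun y => contract (EuclideanSpace.basisFun (Fin m) ℝ)
    (dualCoeff (fderiv ℝ (coordFun s x₀ : RModel m → ℂ) y)) (ζ y)

theorem fderiv_coordFun_ne_zero {s : M → ℂ} {x x₀ : M}
    (hs : MDifferentiableAt 𝓘(ℝ, RModel m) 𝓘(ℝ, ℂ) s x)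
    (hx : x ∈ (chartAt (RModel m) x₀).source) (h : (modelDfun s x : RModel m →L[ℝ] ℂ) ≠ 0) :
    fderiv ℝ (coordFun s x₀ : RModel m → ℂ) (chartAt (RModel m) x₀ x) ≠ 0 := by
  intro h0
  apply h
  rw [fderiv_coordFun hs ((chartAt (RModel m) x₀).map_source hx)
    ((chartAt (RModel m) x₀).left_inv hx)] at h0
  ext v
  have := congrArg (fun A : RModel m →L[ℝ] ℂ => A (modelDeriv (chartAt (RModel m) x₀) x v)) h0
  refine Eq.trans ?_ this
  exact congrArg (modelDfun s x) (mfderiv_chartAt_symm_mfderiv_chartAt hx v).symm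

theorem smoothNear_chartContract {s : M → ℂ} {x x₀ : M}
    (hs : ContMDiffAt 𝓘(ℝ, RModel m) 𝓘(ℝ, ℂ) ∞ s x)
    (hx : x ∈ (chartAt (RModel m) x₀).source) (h : (modelDfun s x : RModel m →L[ℝ] ℂ) ≠ 0)
    {ζ : RModel m → RModel m [⋀^Fin (p + 1)]→L[ℝ] ℂ}
    (hζ : ContDiffAt ℝ ∞ ζ (chartAt (RModel m) x₀ x)) :
    (chartContract s x₀ ζ).SmoothNear x :=
  DForm.smoothNear_ofChart hx (hζ.contract _ (((hs.coordFun hx).fderiv_right (by simp)).dualCoeff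
    (fderiv_coordFun_ne_zero (hs.mdifferentiableAt (by simp)) hx h)))

/-- Here `ψ = ι_Z η` and `θ = ι_Z dη`, where `Z` depends on `s` and the chart alone. Neither
mentions `φ`, so both make sense on `S` as well. -/
theorem local_decomposition {s : M → ℂ} {x x₀ : M}
    (hs : MDifferentiableAt 𝓘(ℝ, RModel m) 𝓘(ℝ, ℂ) s x)
    (hx : x ∈ (chartAt (RModel m) x₀).source) (h : (modelDfun s x : RModel m →L[ℝ] ℂ) ≠ 0)
    (hsx : s x ≠ 0) {φ η : DForm m M (p + 1)} (hη : η.SmoothNear x) (hηφ : η x = s x • φ x)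
    (hdη : η.d x = DForm.dfunWedge s φ x) :
    φ x = (s x)⁻¹ • DForm.dfunWedge s (chartContract s x₀ (η.inChart x₀)) x +
      chartContract s x₀ (extDeriv (η.inChart x₀)) x := by
  have hy := (chartAt (RModel m) x₀).map_source hx
  have hl := (chartAt (RModel m) x₀).left_inv hx
  refine DForm.eq_of_inChart_eq (ζ := (fun x => (s x)⁻¹ •
    DForm.dfunWedge s (chartContract s x₀ (η.inChart x₀)) x) +
      chartContract s x₀ (extDeriv (η.inChart x₀))) hx ?_
  rw [DForm.inChart_add, DForm.inChart_smul, DForm.inChart_dfunWedge _ hs hx, chartContract,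
    chartContract, DForm.inChart_ofChart _ _ hy, DForm.inChart_ofChart _ _ hy, hl]
  refine decomposition_of_wedge_eq _ _ _ (sum_dualCoeff_mul (fderiv_coordFun_ne_zero hs hx h))
    hsx ?_ ?_
  · rw [DForm.inChart_of_symm_eq _ hl, DForm.inChart_of_symm_eq _ hl, hηφ]
    rfl
  · rw [← hη.d_inChart hx, ← DForm.inChart_dfunWedge _ hs hx, DForm.inChart_of_symm_eq _ hl,
      DForm.inChart_of_symm_eq _ hl, hdη]

/-- For a function `φ` the contraction of `ds ∧ φ` is `φ` itself, and no polar term arises. -/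
theorem local_extension {s : M → ℂ} {x x₀ : M}
    (hs : MDifferentiableAt 𝓘(ℝ, RModel m) 𝓘(ℝ, ℂ) s x)
    (hx : x ∈ (chartAt (RModel m) x₀).source) (h : (modelDfun s x : RModel m →L[ℝ] ℂ) ≠ 0)
    {φ η : DForm m M 0} (hη : η.SmoothNear x) (hdη : η.d x = DForm.dfunWedge s φ x) :
    φ x = chartContract s x₀ (extDeriv (η.inChart x₀)) x := by
  have hy := (chartAt (RModel m) x₀).map_source hx
  have hl := (chartAt (RModel m) x₀).left_inv hx
  refine DForm.eq_of_inChart_eq hx ?_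
  have e : η.d.inChart x₀ (chartAt (RModel m) x₀ x) =
      (DForm.dfunWedge s φ).inChart x₀ (chartAt (RModel m) x₀ x) := by
    rw [DForm.inChart_of_symm_eq _ hl, DForm.inChart_of_symm_eq _ hl, hdη]
  rw [chartContract, DForm.inChart_ofChart _ _ hy, ← hη.d_inChart hx, e,
    DForm.inChart_dfunWedge _ hs hx,
    contract_oneWedge_zero _ _ _ (sum_dualCoeff_mul (fderiv_coordFun_ne_zero hs hx h))]

/-- The sum of a family of forms with the weights of a partition of unity. -/
def glueForms (ρ : SmoothPartitionOfUnity M 𝓘(ℝ, RModel m) M univ) (ψ : M → DForm m M p) :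
    DForm m M p := fun x => ∑ i ∈ ρ.finsupport x, (ρ i x : ℂ) • ψ i x

theorem smoothNear_glueForms {ρ : SmoothPartitionOfUnity M 𝓘(ℝ, RModel m) M univ}
    {ψ : M → DForm m M p} {x : M} (h : ∀ i, x ∈ tsupport (ρ i) → (ψ i).SmoothNear x) :
    (glueForms ρ ψ).SmoothNear x := by
  -- The index set `finsupport` varies with the point, but near `x` it stays inside the fixed finite
  -- set `fintsupport x`; the extra terms have weight zero.
  have h1 : DForm.SmoothNear (∑ i ∈ ρ.fintsupport x, fun x => (ρ i x : ℂ) • ψ i x) x := by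
    refine DForm.SmoothNear.sum fun i hi => DForm.SmoothNear.smul ?_
      (h i ((ρ.mem_fintsupport_iff x i).1 hi))
    have h2 : ContMDiffAt 𝓘(ℝ, RModel m) 𝓘(ℝ, ℝ) ∞ (ρ i) x := (ρ i).contMDiff.contMDiffAt
    exact (Complex.ofRealCLM.contDiff.contMDiff.contMDiffAt).comp x h2
  refine h1.congr ?_
  filter_upwards [ρ.eventually_finsupport_subset x] with y hy
  rw [Finset.sum_apply, glueForms]
  refine Finset.sum_subset hy fun i _ hi => ?_
  have : ρ i y = 0 := by
    by_contra h0
    exact hi ((ρ.mem_finsupport y).2 h0)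
  rw [this]
  ext v
  exact zero_mul _

theorem glueForms_const {ρ : SmoothPartitionOfUnity M 𝓘(ℝ, RModel m) M univ} {x : M}
    {ψ : M → DForm m M p} {φ : DForm m M p} (h : ∀ i, x ∈ tsupport (ρ i) → ψ i x = φ x) :
    glueForms ρ ψ x = φ x := by
  have h1 : ∑ i ∈ ρ.finsupport x, (ρ i x : ℂ) = 1 := by
    exact_mod_cast congrArg (fun r : ℝ => (r : ℂ)) (ρ.sum_finsupport x (mem_univ x))
  rw [glueForms, Finset.sum_congr rfl fun i hi => by
    rw [h i (subset_tsupport _ ((ρ.mem_finsupport x).1 hi))], ← Finset.sum_smul, h1, one_smul]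

/-- The right side is pointwise linear in `(ψ, θ)`, and the weights are not differentiated, so one
common `s` lets local decompositions be averaged. -/
theorem glueForms_decomposition (ρ : SmoothPartitionOfUnity M 𝓘(ℝ, RModel m) M univ) (s : M → ℂ)
    (ψ : M → DForm m M p) (θ : M → DForm m M (p + 1)) (x : M) :
    glueForms ρ (fun i x => (s x)⁻¹ • DForm.dfunWedge s (ψ i) x + θ i x) x =
      (s x)⁻¹ • DForm.dfunWedge s (glueForms ρ ψ) x + glueForms ρ θ x := by
  have h : DForm.dfunWedge s (glueForms ρ ψ) x =
      ∑ i ∈ ρ.finsupport x, (ρ i x : ℂ) • DForm.dfunWedge s (ψ i) x := by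
    refine (oneWedge_sum (E := RModel m) (ρ.finsupport x) (modelDfun s x)
      fun i => (ρ i x : ℂ) • ψ i x).trans (Finset.sum_congr rfl fun i _ => ?_)
    exact oneWedge_smul (E := RModel m) _ _ _
  rw [h, glueForms, glueForms, Finset.smul_sum, ← Finset.sum_add_distrib]
  refine Finset.sum_congr rfl fun i _ => ?_
  rw [smul_add, smul_comm]

/-- Leibniz rule for `s φ`; the term `s dφ` is zero. -/
theorem d_eq_dfunWedge_of_closed {s : M → ℂ} {x : M} {φ η : DForm m M p}
    (hs : ContMDiffAt 𝓘(ℝ, RModel m) 𝓘(ℝ, ℂ) ∞ s x) (hφ : φ.SmoothNear x) (hdφ : φ.d x = 0)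
    (h : ∀ᶠ y in 𝓝 x, η y = s y • φ y) : η.d x = DForm.dfunWedge s φ x := by
  rw [DForm.d_congr (η := fun y => s y • φ y) h, DForm.d_smul hs hφ, hdφ]
  ext v
  change DForm.dfunWedge s φ x v + s x * 0 = _
  rw [mul_zero, add_zero]

/-- A closed form `φ` on `U \ S` with `s φ` smooth on `U` and `ds ≠ 0` is `(ds / s) ∧ ψ + θ`. -/
theorem exists_decomposition [T2Space M] [SigmaCompactSpace M] {U S : Set M} (hU : IsOpen U)
    (hS : IsClosed S) {s : M → ℂ} (hs : ContMDiffOn 𝓘(ℝ, RModel m) 𝓘(ℝ, ℂ) ∞ s U)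
    (hs0 : ∀ x ∈ U \ S, s x ≠ 0) (hds : ∀ x ∈ U, (modelDfun s x : RModel m →L[ℝ] ℂ) ≠ 0)
    {φ η : DForm m M (p + 1)} (hη : η.SmoothOn U) (hηφ : ∀ x ∈ U \ S, η x = s x • φ x)
    (hφ : φ.SmoothOn Sᶜ) (hdφ : ∀ x ∈ Sᶜ, φ.d x = 0) :
    ∃ (ψ : DForm m M p) (θ : DForm m M (p + 1)), ψ.SmoothOn U ∧ θ.SmoothOn U ∧
      ∀ x ∈ U \ S, φ x = (s x)⁻¹ • DForm.dfunWedge s ψ x + θ x := by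
  obtain ⟨ρ, hρ⟩ := SmoothPartitionOfUnity.exists_isSubordinate_chartAt_source 𝓘(ℝ, RModel m) M
  have hs' : ∀ x ∈ U, ContMDiffAt 𝓘(ℝ, RModel m) 𝓘(ℝ, ℂ) ∞ s x := fun x hx =>
    hs.contMDiffAt (hU.mem_nhds hx)
  rw [DForm.smoothOn_iff hU] at hη
  rw [DForm.smoothOn_iff hS.isOpen_compl] at hφ
  refine ⟨glueForms ρ fun i => chartContract s i (η.inChart i),
    glueForms ρ fun i => chartContract s i (extDeriv (η.inChart i)), ?_, ?_, ?_⟩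
  · rw [DForm.smoothOn_iff hU]
    exact fun x hx => smoothNear_glueForms fun i hi => smoothNear_chartContract (hs' x hx)
      (hρ i hi) (hds x hx) ((hη x hx).contDiffAt (hρ i hi))
  · rw [DForm.smoothOn_iff hU]
    exact fun x hx => smoothNear_glueForms fun i hi => smoothNear_chartContract (hs' x hx)
      (hρ i hi) (hds x hx) ((hη x hx).contDiffAt (hρ i hi)).extDeriv
  · intro x hx
    rw [← glueForms_decomposition]
    -- Every chart whose weight is supported at `x` reproduces the same value `φ x`, and the weights
    -- sum to one.
    refine (glueForms_const fun i hi => ?_).symm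
    refine (local_decomposition ((hs' x hx.1).mdifferentiableAt (by simp)) (hρ i hi) (hds x hx.1)
      (hs0 x hx) (hη x hx.1) (hηφ x hx) ?_).symm
    refine d_eq_dfunWedge_of_closed (hs' x hx.1) (hφ x hx.2) (hdφ x hx.2) ?_
    filter_upwards [(hU.sdiff hS).mem_nhds hx] with y hy using hηφ y hy

/-- A closed function `φ` on `U \ S` with `s φ` smooth on `U` and `ds ≠ 0` extends to `U`. -/
theorem exists_extension [T2Space M] [SigmaCompactSpace M] {U S : Set M} (hU : IsOpen U)
    (hS : IsClosed S) {s : M → ℂ} (hs : ContMDiffOn 𝓘(ℝ, RModel m) 𝓘(ℝ, ℂ) ∞ s U)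
    (hds : ∀ x ∈ U, (modelDfun s x : RModel m →L[ℝ] ℂ) ≠ 0)
    {φ η : DForm m M 0} (hη : η.SmoothOn U) (hηφ : ∀ x ∈ U \ S, η x = s x • φ x)
    (hφ : φ.SmoothOn Sᶜ) (hdφ : ∀ x ∈ Sᶜ, φ.d x = 0) :
    ∃ θ : DForm m M 0, θ.SmoothOn U ∧ ∀ x ∈ U \ S, φ x = θ x := by
  obtain ⟨ρ, hρ⟩ := SmoothPartitionOfUnity.exists_isSubordinate_chartAt_source 𝓘(ℝ, RModel m) M
  have hs' : ∀ x ∈ U, ContMDiffAt 𝓘(ℝ, RModel m) 𝓘(ℝ, ℂ) ∞ s x := fun x hx =>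
    hs.contMDiffAt (hU.mem_nhds hx)
  rw [DForm.smoothOn_iff hU] at hη
  rw [DForm.smoothOn_iff hS.isOpen_compl] at hφ
  refine ⟨glueForms ρ fun i => chartContract s i (extDeriv (η.inChart i)), ?_, ?_⟩
  · rw [DForm.smoothOn_iff hU]
    exact fun x hx => smoothNear_glueForms fun i hi => smoothNear_chartContract (hs' x hx)
      (hρ i hi) (hds x hx) ((hη x hx).contDiffAt (hρ i hi)).extDeriv
  · intro x hx
    refine (glueForms_const fun i hi => ?_).symm
    refine (local_extension ((hs' x hx.1).mdifferentiableAt (by simp)) (hρ i hi) (hds x hx.1)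
      (hη x hx.1) ?_).symm
    refine d_eq_dfunWedge_of_closed (hs' x hx.1) (hφ x hx.2) (hdφ x hx.2) ?_
    filter_upwards [(hU.sdiff hS).mem_nhds hx] with y hy using hηφ y hy

end Local

/-! ### Limits along transversal lines, and the identity obtained by differentiating the
decomposition. -/

section Approach

open Filter

variable {E : Type*} [NormedAddCommGroup E] [NormedSpace ℝ E]

theorem tendsto_line (c v : E) : Tendsto (fun t : ℝ => c + t • v) (𝓝[≠] 0) (𝓝 c) := by
  have h : Continuous fun t : ℝ => c + t • v := by fun_prop
  have h0 := h.tendsto 0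
  simp only [zero_smul, add_zero] at h0
  exact h0.mono_left nhdsWithin_le_nhds

theorem tendsto_slope_line {f : E → ℂ} {c : E} (hf : DifferentiableAt ℝ f c) (hc : f c = 0)
    (v : E) : Tendsto (fun t : ℝ => (t : ℂ)⁻¹ * f (c + t • v)) (𝓝[≠] 0) (𝓝 (fderiv ℝ f c v)) := by
  have h := (hf.hasFDerivAt.hasLineDerivAt v).tendsto_slope_zero
  simpa [hc] using h

theorem eventually_ne_zero_line {f : E → ℂ} {c v : E} (hf : DifferentiableAt ℝ f c)
    (hc : f c = 0) (hv : fderiv ℝ f c v ≠ 0) : ∀ᶠ t : ℝ in 𝓝[≠] 0, f (c + t • v) ≠ 0 := by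
  filter_upwards [(tendsto_slope_line hf hc v).eventually_ne hv] with t ht h0
  exact ht (by rw [h0, mul_zero])

/-- A first order l'Hôpital rule: both functions vanish at `c`, so their quotient is the quotient of
their slopes. The direction must be transversal only to the zero set of the denominator. -/
theorem tendsto_div_line {f g : E → ℂ} {c v : E} (hf : DifferentiableAt ℝ f c)
    (hg : DifferentiableAt ℝ g c) (hfc : f c = 0) (hgc : g c = 0) (hv : fderiv ℝ f c v ≠ 0) :
    Tendsto (fun t : ℝ => g (c + t • v) / f (c + t • v)) (𝓝[≠] 0)
      (𝓝 (fderiv ℝ g c v / fderiv ℝ f c v)) := by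
  refine ((tendsto_slope_line hg hgc v).div (tendsto_slope_line hf hfc v) hv).congr' ?_
  filter_upwards [self_mem_nhdsWithin] with t ht
  have ht' : (t : ℂ)⁻¹ ≠ 0 := inv_ne_zero (Complex.ofReal_ne_zero.2 ht)
  exact mul_div_mul_left _ _ ht'

/-- A continuous function that vanishes off the zeros of `f` vanishes at a zero of `f` at which
the differential of `f` is nonzero. -/
theorem eq_zero_of_eventually {G : Type*} [NormedAddCommGroup G] {f : E → ℂ} {g : E → G} {c : E}
    (hf : DifferentiableAt ℝ f c) (hc : f c = 0) (hdf : fderiv ℝ f c ≠ 0) (hg : ContinuousAt g c)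
    (h : ∀ᶠ y in 𝓝 c, f y ≠ 0 → g y = 0) : g c = 0 := by
  -- Along a line in direction `v` the function `f` has no zeros near `c` except `c`, so `c` is a
  -- limit of points where `g` vanishes.
  obtain ⟨v, hv⟩ : ∃ v, fderiv ℝ f c v ≠ 0 := by
    by_contra! h0
    exact hdf (ContinuousLinearMap.ext h0)
  have h1 : Tendsto (fun t : ℝ => g (c + t • v)) (𝓝[≠] 0) (𝓝 (g c)) :=
    hg.tendsto.comp (tendsto_line c v)
  have h2 : Tendsto (fun t : ℝ => g (c + t • v)) (𝓝[≠] 0) (𝓝 0) := by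
    refine tendsto_const_nhds.congr' ?_
    filter_upwards [eventually_ne_zero_line hf hc hv, (tendsto_line c v).eventually h] with t h3 h4
    exact (h4 h3).symm
  exact tendsto_nhds_unique h1 h2

/-- Two proper subspaces do not cover a vector space. This gives one direction transversal for two
defining functions at once. -/
theorem exists_ne_zero_ne_zero {α β : E →L[ℝ] ℂ} (hα : α ≠ 0) (hβ : β ≠ 0) :
    ∃ v, α v ≠ 0 ∧ β v ≠ 0 := by
  obtain ⟨a, ha⟩ : ∃ v, α v ≠ 0 := by
    by_contra! h0
    exact hα (ContinuousLinearMap.ext h0)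
  obtain ⟨b, hb⟩ : ∃ v, β v ≠ 0 := by
    by_contra! h0
    exact hβ (ContinuousLinearMap.ext h0)
  by_cases h1 : β a = 0
  · by_cases h2 : α b = 0
    · exact ⟨a + b, by simpa [h2] using ha, by simpa [h1] using hb⟩
    · exact ⟨b, h2, hb⟩
  · exact ⟨a, ha, h1⟩

variable [FiniteDimensional ℝ E] {p : ℕ}

/-- Write `df ∧ ψ = d(f ψ) - f dψ` and apply `d ∘ d = 0` to both `f ψ` and `ψ`. -/
theorem extDeriv_oneWedge_fderiv {f : E → ℂ} {ψ : E → E [⋀^Fin p]→L[ℝ] ℂ} {c : E}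
    (hf : ContDiffAt ℝ ∞ f c) (hψ : ContDiffAt ℝ ∞ ψ c) :
    extDeriv (fun y => oneWedge (fderiv ℝ f y) (ψ y)) c =
      -oneWedge (fderiv ℝ f c) (extDeriv ψ c) := by
  have hf1 := (hf.of_le (m := 1) (by simp)).eventually (by simp)
  have hψ1 := (hψ.of_le (m := 1) (by simp)).eventually (by simp)
  have e : (fun y => oneWedge (fderiv ℝ f y) (ψ y)) =ᶠ[𝓝 c]
      fun y => extDeriv (fun y => f y • ψ y) y + ((-1 : ℂ) * f y) • extDeriv ψ y := by
    filter_upwards [hf1, hψ1] with y hfy hψy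
    rw [extDeriv_fun_smul_form (hfy.differentiableAt (by simp)) (hψy.differentiableAt (by simp)),
      mul_smul, neg_one_smul]
    abel
  have hd : ContDiffAt ℝ ∞ (extDeriv ψ) c :=
    ((ContinuousAlternatingMap.alternatizeUncurryFinCLM ℝ E ℂ).contDiff.contDiffAt).comp c
      (hψ.fderiv_right (by simp))
  have hd2 : ContDiffAt ℝ ∞ (extDeriv (fun y => f y • ψ y)) c :=
    ((ContinuousAlternatingMap.alternatizeUncurryFinCLM ℝ E ℂ).contDiff.contDiffAt).comp c
      ((hf.smul hψ).fderiv_right (by simp))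
  have hdd : extDeriv (extDeriv fun y => f y • ψ y) c = 0 :=
    extDeriv_extDeriv_apply (r := ∞) (hf.smul hψ) (by simpa using two_le_infty)
  have hnf : ContDiffAt ℝ ∞ (fun y => (-1 : ℂ) * f y) c := contDiffAt_const.mul hf
  have hnfd : ContDiffAt ℝ ∞ (fun y => ((-1 : ℂ) * f y) • extDeriv ψ y) c := hnf.smul hd
  rw [e.extDeriv_eq, extDeriv_fun_add (hd2.differentiableAt (by simp))
    (hnfd.differentiableAt (by simp)),
    hdd, extDeriv_fun_smul_form (hnf.differentiableAt (by simp)) (hd.differentiableAt (by simp)),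
    extDeriv_extDeriv_apply (r := ∞) hψ (by simpa using two_le_infty), smul_zero, add_zero,
    zero_add, fderiv_const_mul (hf.differentiableAt (by simp))]
  ext v
  simp [oneWedge_apply, Finset.sum_neg_distrib]

/-- Differentiate `f φ = df ∧ ψ + f θ`. The left side gives `df ∧ φ = df ∧ θ`, since `df ∧ df ∧ ψ =
0`; the right side gives `-df ∧ dψ + df ∧ θ + f dθ`. The resulting identity has no denominator, so
it survives passage to zeros of `f`. -/
theorem oneWedge_extDeriv_of_closed {f : E → ℂ} {ψ : E → E [⋀^Fin p]→L[ℝ] ℂ}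
    {φ θ : E → E [⋀^Fin (p + 1)]→L[ℝ] ℂ} {c : E}
    (hf : ContDiffAt ℝ ∞ f c) (hψ : ContDiffAt ℝ ∞ ψ c) (hθ : ContDiffAt ℝ ∞ θ c)
    (hφ : ContDiffAt ℝ ∞ φ c) (hdφ : extDeriv φ c = 0) (hfc : f c ≠ 0)
    (h : ∀ᶠ y in 𝓝 c, φ y = (f y)⁻¹ • oneWedge (fderiv ℝ f y) (ψ y) + θ y) :
    oneWedge (fderiv ℝ f c) (extDeriv ψ c) = f c • extDeriv θ c := by
  have e : (fun y => f y • φ y) =ᶠ[𝓝 c]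
      fun y => oneWedge (fderiv ℝ f y) (ψ y) + f y • θ y := by
    filter_upwards [h, hf.continuousAt.eventually_ne hfc] with y hy hfy
    rw [hy, smul_add, smul_smul, mul_inv_cancel₀ hfy, one_smul]
  have h1 := e.extDeriv_eq
  have hw : ContDiffAt ℝ ∞ (fun y => oneWedge (fderiv ℝ f y) (ψ y)) c :=
    hψ.oneWedge (hf.fderiv_right (by simp))
  have hww : (f c)⁻¹ • oneWedge (fderiv ℝ f c) (oneWedge (fderiv ℝ f c) (ψ c)) = 0 := by
    rw [oneWedge_oneWedge]
    ext v
    exact mul_zero _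
  have hfθ : ContDiffAt ℝ ∞ (fun y => f y • θ y) c := hf.smul hθ
  rw [extDeriv_fun_smul_form (hf.differentiableAt (by simp)) (hφ.differentiableAt (by simp)), hdφ,
    extDeriv_fun_add (hw.differentiableAt (by simp)) (hfθ.differentiableAt (by simp)),
    extDeriv_fun_smul_form (hf.differentiableAt (by simp)) (hθ.differentiableAt (by simp)),
    extDeriv_oneWedge_fderiv hf hψ, h.self_of_nhds, oneWedge_add, oneWedge_smul,
    hww, zero_add, smul_zero, add_zero] at h1
  have h2 : oneWedge (fderiv ℝ f c) (θ c) + (f c • extDeriv θ c -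
      oneWedge (fderiv ℝ f c) (extDeriv ψ c)) = oneWedge (fderiv ℝ f c) (θ c) + 0 := by
    rw [add_zero]
    conv_rhs => rw [h1]
    abel
  exact (sub_eq_zero.1 (add_left_cancel h2)).symm

end Approach

/-! ### Behaviour of the decomposition at points of `S`. -/

section Boundary

open Filter

variable {m : ℕ} {M : Type*} [TopologicalSpace M] [ChartedSpace (RModel m) M]
  [IsManifold 𝓘(ℝ, RModel m) ∞ M] {p : ℕ}

/-- `s` is a smooth function on the open set `U` with zero set `S ∩ U` and with `ds ≠ 0`. -/
structure IsDefiningFunction (m : ℕ) {M : Type*} [TopologicalSpace M]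
    [ChartedSpace (RModel m) M] (S U : Set M) (s : M → ℂ) : Prop where
  isOpen : IsOpen U
  contMDiffAt : ∀ x ∈ U, ContMDiffAt 𝓘(ℝ, RModel m) 𝓘(ℝ, ℂ) ∞ s x
  zero_iff : ∀ x ∈ U, s x = 0 ↔ x ∈ S
  differential_ne_zero : ∀ x ∈ U, (modelDfun s x : RModel m →L[ℝ] ℂ) ≠ 0

theorem eventually_chartAt_symm {x : M} {P : M → Prop} (h : ∀ᶠ x' in 𝓝 x, P x') :
    ∀ᶠ y in 𝓝 (chartAt (RModel m) x x), P ((chartAt (RModel m) x).symm y) := by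
  have hc := (chartAt (RModel m) x).continuousAt_symm (mem_chart_target _ x)
  rw [ContinuousAt, (chartAt (RModel m) x).left_inv (mem_chart_source _ x)] at hc
  exact hc h

theorem fderiv_coordFun_modelDeriv {s : M → ℂ} {x : M}
    (hs : MDifferentiableAt 𝓘(ℝ, RModel m) 𝓘(ℝ, ℂ) s x) (v : RModel m) :
    fderiv ℝ (coordFun s x : RModel m → ℂ) (chartAt (RModel m) x x)
      (modelDeriv (chartAt (RModel m) x) x v) = (modelDfun s x : RModel m →L[ℝ] ℂ) v := by
  rw [fderiv_coordFun hs (mem_chart_target _ x)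
    ((chartAt (RModel m) x).left_inv (mem_chart_source _ x))]
  exact congrArg (modelDfun s x) (mfderiv_chartAt_symm_mfderiv_chartAt (mem_chart_source _ x) v)

/-- The expression of `φ = (ds / s) ∧ ψ + θ` in a chart. -/
theorem inChart_decomposition {s : M → ℂ} {x x₀ : M}
    (hs : MDifferentiableAt 𝓘(ℝ, RModel m) 𝓘(ℝ, ℂ) s x)
    (hx : x ∈ (chartAt (RModel m) x₀).source) {φ θ : DForm m M (p + 1)} {ψ : DForm m M p}
    (h : φ x = (s x)⁻¹ • DForm.dfunWedge s ψ x + θ x) :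
    φ.inChart x₀ (chartAt (RModel m) x₀ x) = (coordFun s x₀ (chartAt (RModel m) x₀ x))⁻¹ •
      oneWedge (fderiv ℝ (coordFun s x₀ : RModel m → ℂ) (chartAt (RModel m) x₀ x))
        (ψ.inChart x₀ (chartAt (RModel m) x₀ x)) + θ.inChart x₀ (chartAt (RModel m) x₀ x) := by
  have hl := (chartAt (RModel m) x₀).left_inv hx
  have e : φ.inChart x₀ (chartAt (RModel m) x₀ x) =
      DForm.inChart ((fun x => (s x)⁻¹ • DForm.dfunWedge s ψ x) + θ) x₀
        (chartAt (RModel m) x₀ x) := by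
    rw [DForm.inChart_of_symm_eq _ hl, DForm.inChart_of_symm_eq _ hl, h]
    rfl
  rw [e, DForm.inChart_add, DForm.inChart_smul, DForm.inChart_dfunWedge _ hs hx]
  rfl

variable {S U : Set M} {s : M → ℂ} {φ θ : DForm m M (p + 1)} {ψ : DForm m M p}

theorem IsDefiningFunction.coordFun_eq_zero (hs : IsDefiningFunction m S U s) {x : M}
    (hx : x ∈ U) (hxS : x ∈ S) : (coordFun s x : RModel m → ℂ) (chartAt (RModel m) x x) = 0 := by
  change s ((chartAt (RModel m) x).symm (chartAt (RModel m) x x)) = 0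
  rw [(chartAt (RModel m) x).left_inv (mem_chart_source _ x)]
  exact (hs.zero_iff x hx).2 hxS

/-- In the chart at a point of `S ∩ U`, the decomposition of `φ` holds off the zeros of `s`. -/
theorem IsDefiningFunction.eventually_inChart (hs : IsDefiningFunction m S U s)
    (hdec : ∀ x ∈ U \ S, φ x = (s x)⁻¹ • DForm.dfunWedge s ψ x + θ x) {x : M} (hx : x ∈ U) :
    ∀ᶠ y in 𝓝 (chartAt (RModel m) x x), (coordFun s x : RModel m → ℂ) y ≠ 0 →
      φ.inChart x y = (coordFun s x y)⁻¹ •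
        oneWedge (fderiv ℝ (coordFun s x : RModel m → ℂ) y) (ψ.inChart x y) + θ.inChart x y := by
  filter_upwards [eventually_chartAt_symm (hs.isOpen.mem_nhds hx),
    (chartAt (RModel m) x).open_target.mem_nhds (mem_chart_target _ x)] with y hyU hy h0
  have h := inChart_decomposition (x₀ := x) ((hs.contMDiffAt _ hyU).mdifferentiableAt (by simp))
    ((chartAt (RModel m) x).map_target hy)
    (hdec _ ⟨hyU, fun hS => h0 ((hs.zero_iff _ hyU).2 hS)⟩)
  rwa [(chartAt (RModel m) x).right_inv hy] at h

/-- In a chart, `ds ∧ dψ - s dθ` is continuous and vanishes off `S`, hence also at `x`, where the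
second term is zero. -/
theorem IsDefiningFunction.dfunWedge_d_eq_zero (hs : IsDefiningFunction m S U s) (hS : IsClosed S)
    (hφ : φ.SmoothOn Sᶜ) (hdφ : ∀ x ∈ Sᶜ, φ.d x = 0) (hψ : ψ.SmoothOn U) (hθ : θ.SmoothOn U)
    (hdec : ∀ x ∈ U \ S, φ x = (s x)⁻¹ • DForm.dfunWedge s ψ x + θ x) {x : M} (hx : x ∈ U)
    (hxS : x ∈ S) : DForm.dfunWedge s ψ.d x = 0 := by
  rw [DForm.smoothOn_iff hs.isOpen] at hψ hθ
  rw [DForm.smoothOn_iff hS.isOpen_compl] at hφ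
  have hsx := hs.contMDiffAt x hx
  have hsrc := mem_chart_source (RModel m) x
  have hl := (chartAt (RModel m) x).left_inv hsrc
  have hf := hsx.coordFun hsrc
  have hf0 : (coordFun s x : RModel m → ℂ) (chartAt (RModel m) x x) = 0 :=
    hs.coordFun_eq_zero hx hxS
  have hψx : ContDiffAt ℝ ∞ (ψ.inChart x) (chartAt (RModel m) x x) := hψ x hx
  have hθx : ContDiffAt ℝ ∞ (θ.inChart x) (chartAt (RModel m) x x) := hθ x hx
  have key := eq_zero_of_eventually
    (g := fun y => oneWedge (fderiv ℝ (coordFun s x : RModel m → ℂ) y) (extDeriv (ψ.inChart x) y) -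
      coordFun s x y • extDeriv (θ.inChart x) y)
    (hf.differentiableAt (by simp)) hf0
    (fderiv_coordFun_ne_zero (hsx.mdifferentiableAt (by simp)) hsrc (hs.differential_ne_zero x hx))
    ((hψx.extDeriv.oneWedge (hf.fderiv_right (by simp))).continuousAt.sub
      (hf.smul hθx.extDeriv).continuousAt) ?_
  · refine DForm.eq_of_inChart_eq (ζ := 0) hsrc ?_
    rw [DForm.inChart_dfunWedge _ (hsx.mdifferentiableAt (by simp)) hsrc, (hψ x hx).d_inChart hsrc]
    rw [hf0, zero_smul, sub_zero] at key
    rw [key]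
    rfl
  · have hev := hs.eventually_inChart hdec hx
    filter_upwards [eventually_chartAt_symm (hs.isOpen.mem_nhds hx),
      (chartAt (RModel m) x).open_target.mem_nhds (mem_chart_target _ x),
      eventually_eventually_nhds.2 hev] with y hyU hy hey h0
    have hyS : (chartAt (RModel m) x).symm y ∈ Sᶜ := fun h => h0 ((hs.zero_iff _ hyU).2 h)
    have hys := (chartAt (RModel m) x).map_target hy
    have hr := (chartAt (RModel m) x).right_inv hy
    have h1 := (hs.contMDiffAt _ hyU).coordFun hys
    have h2 := (hψ _ hyU).contDiffAt hys
    have h3 := (hθ _ hyU).contDiffAt hys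
    have h4 := (hφ _ hyS).contDiffAt hys
    have h5 := (hφ _ hyS).d_inChart hys
    rw [DForm.inChart_of_symm_eq _ ((chartAt (RModel m) x).left_inv hys), hdφ _ hyS] at h5
    rw [hr] at h1 h2 h3 h4 h5
    refine sub_eq_zero.2 (oneWedge_extDeriv_of_closed h1 h2 h3 h4 (h5.symm.trans rfl) h0 ?_)
    filter_upwards [hey, h1.continuousAt.eventually_ne h0] with z hz hz0 using hz hz0

/-- `s φ` tends to `ds ∧ ψ` at the points of `S ∩ U`. -/
theorem IsDefiningFunction.tendsto_smul (hs : IsDefiningFunction m S U s)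
    (hψ : ψ.SmoothOn U) (hθ : θ.SmoothOn U)
    (hdec : ∀ x ∈ U \ S, φ x = (s x)⁻¹ • DForm.dfunWedge s ψ x + θ x) {x : M} (hx : x ∈ U)
    (hxS : x ∈ S) {l : Filter ℝ} {γ : ℝ → RModel m} (hγ : Tendsto γ l (𝓝 (chartAt (RModel m) x x)))
    (h0 : ∀ᶠ t in l, coordFun s x (γ t) ≠ 0) :
    Tendsto (fun t => coordFun s x (γ t) • φ.inChart x (γ t)) l
      (𝓝 ((DForm.dfunWedge s ψ).inChart x (chartAt (RModel m) x x))) := by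
  rw [DForm.smoothOn_iff hs.isOpen] at hψ hθ
  have hsx := hs.contMDiffAt x hx
  have hsrc := mem_chart_source (RModel m) x
  have hf := hsx.coordFun hsrc
  have hf0 : (coordFun s x : RModel m → ℂ) (chartAt (RModel m) x x) = 0 :=
    hs.coordFun_eq_zero hx hxS
  have hψx : ContDiffAt ℝ ∞ (ψ.inChart x) (chartAt (RModel m) x x) := hψ x hx
  have hθx : ContDiffAt ℝ ∞ (θ.inChart x) (chartAt (RModel m) x x) := hθ x hx
  have hc := (hψx.oneWedge (hf.fderiv_right (by simp))).continuousAt.add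
    (hf.smul hθx).continuousAt
  have hc2 := hc.tendsto.comp hγ
  simp only [Pi.add_apply, Pi.smul_apply', hf0, zero_smul, add_zero] at hc2
  rw [DForm.inChart_dfunWedge _ (hsx.mdifferentiableAt (by simp)) hsrc]
  refine hc2.congr' ?_
  filter_upwards [h0, hγ.eventually (hs.eventually_inChart hdec hx)] with t ht0 ht
  rw [Function.comp_apply, ht ht0, smul_add, smul_smul, mul_inv_cancel₀ ht0, one_smul]
  rfl

/-- Two decompositions of `φ` have proportional leading terms at the points of `S`. -/
theorem IsDefiningFunction.smul_dfunWedge_eq (hs : IsDefiningFunction m S U s)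
    (hψ : ψ.SmoothOn U) (hθ : θ.SmoothOn U)
    (hdec : ∀ x ∈ U \ S, φ x = (s x)⁻¹ • DForm.dfunWedge s ψ x + θ x)
    {U' : Set M} {s' : M → ℂ} {θ' : DForm m M (p + 1)} {ψ' : DForm m M p}
    (hs' : IsDefiningFunction m S U' s') (hψ' : ψ'.SmoothOn U') (hθ' : θ'.SmoothOn U')
    (hdec' : ∀ x ∈ U' \ S, φ x = (s' x)⁻¹ • DForm.dfunWedge s' ψ' x + θ' x)
    {x : M} (hx : x ∈ U) (hx' : x ∈ U') (hxS : x ∈ S) {v : RModel m}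
    (hv : (modelDfun s x : RModel m →L[ℝ] ℂ) v ≠ 0)
    (hv' : (modelDfun s' x : RModel m →L[ℝ] ℂ) v ≠ 0) :
    (modelDfun s x : RModel m →L[ℝ] ℂ) v • DForm.dfunWedge s' ψ' x =
      (modelDfun s' x : RModel m →L[ℝ] ℂ) v • DForm.dfunWedge s ψ x := by
  have hsx := hs.contMDiffAt x hx
  have hsx' := hs'.contMDiffAt x hx'
  have hsrc := mem_chart_source (RModel m) x
  have hl := (chartAt (RModel m) x).left_inv hsrc
  have hf := (hsx.coordFun hsrc).differentiableAt (n := ∞) (by simp)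
  have hf' := (hsx'.coordFun hsrc).differentiableAt (n := ∞) (by simp)
  have hf0 : (coordFun s x : RModel m → ℂ) (chartAt (RModel m) x x) = 0 :=
    hs.coordFun_eq_zero hx hxS
  have hf0' : (coordFun s' x : RModel m → ℂ) (chartAt (RModel m) x x) = 0 :=
    hs'.coordFun_eq_zero hx' hxS
  rw [← fderiv_coordFun_modelDeriv (hsx.mdifferentiableAt (by simp))] at hv
  rw [← fderiv_coordFun_modelDeriv (hsx'.mdifferentiableAt (by simp))] at hv'
  rw [← fderiv_coordFun_modelDeriv (hsx.mdifferentiableAt (by simp)),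
    ← fderiv_coordFun_modelDeriv (hsx'.mdifferentiableAt (by simp))]
  set a := fderiv ℝ (coordFun s x : RModel m → ℂ) (chartAt (RModel m) x x)
      (modelDeriv (chartAt (RModel m) x) x v) with ha
  set a' := fderiv ℝ (coordFun s' x : RModel m → ℂ) (chartAt (RModel m) x x)
      (modelDeriv (chartAt (RModel m) x) x v) with ha'
  have hγ := tendsto_line (chartAt (RModel m) x x)
    (modelDeriv (chartAt (RModel m) x) x v : RModel m)
  have hne := eventually_ne_zero_line hf hf0 hv
  have hne' := eventually_ne_zero_line hf' hf0' hv'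
  have h1 := hs.tendsto_smul hψ hθ hdec hx hxS hγ hne
  have h2 := hs'.tendsto_smul hψ' hθ' hdec' hx' hxS hγ hne'
  -- Compare two limits of `s' φ = (s'/s) (s φ)` along the line: one is `ds' ∧ ψ'`, the other is
  -- `(a'/a) ds ∧ ψ`.
  have h3 := (tendsto_div_line hf hf' hf0 hf0' hv).smul h1
  have h4 := tendsto_nhds_unique_of_eventuallyEq h2 h3 (by
    filter_upwards [hne] with t ht
    rw [smul_smul, div_mul_cancel₀ _ ht])
  refine DForm.eq_of_inChart_eq (η := fun y => a • DForm.dfunWedge s' ψ' y)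
    (ζ := fun y => a' • DForm.dfunWedge s ψ y) hsrc ?_
  rw [DForm.inChart_smul (fun _ => a), DForm.inChart_smul (fun _ => a'), h4, smul_smul,
    mul_div_cancel₀ _ hv]

end Boundary

/-! ### Powers of the ideal: membership in `I^p` in degree `p` as annihilation by `T`. -/

section IdealPowers

variable {E : Type*} [AddCommGroup E] [Module ℝ E]

/-- The product is a sum over shuffles, that is, over cosets of permutations. Multiplying by `a! b!`
replaces it by a sum over all permutations, which is easier to handle. -/
theorem factorial_mul_altWedge {a b : ℕ} (α : E [⋀^Fin a]→ₗ[ℝ] ℂ) (β : E [⋀^Fin b]→ₗ[ℝ] ℂ)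
    (v : Fin (a + b) → E) :
    ((a.factorial * b.factorial : ℕ) : ℂ) * altWedge α β v =
      ∑ σ : Equiv.Perm (Fin a ⊕ Fin b), ((Equiv.Perm.sign σ : ℤ) : ℂ) *
        (α (fun i => v (finSumFinEquiv (σ (Sum.inl i)))) *
          β (fun j => v (finSumFinEquiv (σ (Sum.inr j))))) := by
  have h := MultilinearMap.domCoprod_alternization_eq α β
  have h2 := congrArg (fun f : E [⋀^Fin a ⊕ Fin b]→ₗ[ℝ] TensorProduct ℝ ℂ ℂ =>
    LinearMap.mul' ℝ ℂ (f fun i => v (finSumFinEquiv i))) h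
  simp only [Fintype.card_fin] at h2
  have h3 : altWedge α β v = LinearMap.mul' ℝ ℂ (α.domCoprod β fun i => v (finSumFinEquiv i)) :=
    rfl
  rw [h3, ← nsmul_eq_mul, ← map_nsmul, ← AlternatingMap.smul_apply]
  refine h2.symm.trans ?_
  rw [MultilinearMap.alternatization_apply, map_sum]
  refine Finset.sum_congr rfl fun σ _ => ?_
  rw [Units.smul_def, map_zsmul, zsmul_eq_mul]
  rfl

/-- A subset of the `a + b` slots is a pair of subsets of the two blocks, and its power of `I` is
the product of theirs. -/
theorem complexEval_factor {a b : ℕ} (α : E [⋀^Fin a]→ₗ[ℝ] ℂ) (β : E [⋀^Fin b]→ₗ[ℝ] ℂ)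
    (e : Fin a ⊕ Fin b ≃ Fin (a + b)) (Z : Fin (a + b) → E × E) :
    ∑ t : Finset (Fin (a + b)), Complex.I ^ t.card *
      (α (fun i => if e (Sum.inl i) ∈ t then (Z (e (Sum.inl i))).2 else (Z (e (Sum.inl i))).1) *
        β (fun j => if e (Sum.inr j) ∈ t then (Z (e (Sum.inr j))).2 else (Z (e (Sum.inr j))).1)) =
    complexEval α (fun i => Z (e (Sum.inl i))) * complexEval β (fun j => Z (e (Sum.inr j))) := by
  rw [complexEval, complexEval, Finset.sum_mul_sum, ← Fintype.sum_prod_type']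
  symm
  refine Fintype.sum_equiv (Finset.sumEquiv.symm.toEquiv.trans e.finsetCongr) _ _ fun t => ?_
  have h1 : ∀ i, e (Sum.inl i) ∈ (Finset.sumEquiv.symm.toEquiv.trans e.finsetCongr) t ↔ i ∈ t.1 := by
    intro i
    simp
  have h2 : ∀ i, e (Sum.inr i) ∈ (Finset.sumEquiv.symm.toEquiv.trans e.finsetCongr) t ↔ i ∈ t.2 := by
    intro i
    simp
  have h3 : ((Finset.sumEquiv.symm.toEquiv.trans e.finsetCongr) t).card = t.1.card + t.2.card := by
    simp
  simp only [h1, h2, h3, pow_add]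
  ring

/-- Complex multilinear extension is compatible with the wedge product: exchange the sums over
subsets and permutations and factor each permuted term. -/
theorem factorial_mul_complexEval_altWedge {a b : ℕ} (α : E [⋀^Fin a]→ₗ[ℝ] ℂ)
    (β : E [⋀^Fin b]→ₗ[ℝ] ℂ) (Z : Fin (a + b) → E × E) :
    ((a.factorial * b.factorial : ℕ) : ℂ) * complexEval (altWedge α β) Z =
      ∑ σ : Equiv.Perm (Fin a ⊕ Fin b), ((Equiv.Perm.sign σ : ℤ) : ℂ) *
        (complexEval α (fun i => Z (finSumFinEquiv (σ (Sum.inl i)))) *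
          complexEval β (fun j => Z (finSumFinEquiv (σ (Sum.inr j))))) := by
  have h : ∀ σ : Equiv.Perm (Fin a ⊕ Fin b), _ := fun σ =>
    complexEval_factor α β (σ.trans finSumFinEquiv) Z
  simp only [Equiv.trans_apply] at h
  simp only [← h]
  rw [complexEval, Finset.mul_sum]
  simp only [Finset.mul_sum]
  rw [Finset.sum_comm]
  refine Finset.sum_congr rfl fun t _ => ?_
  rw [mul_left_comm, factorial_mul_altWedge, Finset.mul_sum]
  exact Finset.sum_congr rfl fun σ _ => mul_left_comm _ _ _

theorem complexEval_add {m : ℕ} (α β : E [⋀^Fin m]→ₗ[ℝ] ℂ) (Z : Fin m → E × E) :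
    complexEval (α + β) Z = complexEval α Z + complexEval β Z := by
  simp [complexEval, mul_add, Finset.sum_add_distrib]

theorem complexEval_smul {m : ℕ} (c : ℂ) (α : E [⋀^Fin m]→ₗ[ℝ] ℂ) (Z : Fin m → E × E) :
    complexEval (c • α) Z = c * complexEval α Z := by
  simp only [complexEval, AlternatingMap.smul_apply, smul_eq_mul, Finset.mul_sum]
  exact Finset.sum_congr rfl fun t _ => by ring

open Classical in
/-- A form of degree `m` in the `p`-th power of the ideal vanishes on tuples with more than `m - p`
entries in `T`. -/
theorem complexEval_eq_zero_of_mem_idealPow {T : Set (E × E)} {p : ℕ} :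
    ∀ {m : ℕ} {η : E [⋀^Fin m]→ₗ[ℝ] ℂ}, η ∈ idealPow T p m → ∀ Z : Fin m → E × E,
      m < (∑ j, if Z j ∈ T then 1 else 0) + p → complexEval η Z = 0 := by
  induction p with
  | zero =>
    intro m η _ Z h
    have : (∑ j, if Z j ∈ T then 1 else 0) ≤ ∑ _j : Fin m, 1 :=
      Finset.sum_le_sum fun j _ => by split_ifs <;> simp
    simp only [Finset.sum_const, Finset.card_univ, Fintype.card_fin, smul_eq_mul, mul_one] at this
    omega
  | succ p ih =>
    intro m η hη Z h
    rw [idealPow] at hη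
    induction hη using Submodule.span_induction with
    | zero => simp [complexEval]
    | add x y _ _ hx hy => rw [complexEval_add, hx, hy, add_zero]
    | smul c x _ hx => rw [complexEval_smul, hx, mul_zero]
    | mem η hη =>
      obtain ⟨a, b, hab, α, hα, β, hβ, rfl⟩ := hη
      subst hab
      have e : (altWedge α β).domDomCongr (finCongr rfl) = altWedge α β := rfl
      rw [e]
      have hne : ((a.factorial * b.factorial : ℕ) : ℂ) ≠ 0 :=
        Nat.cast_ne_zero.2 (Nat.mul_ne_zero a.factorial_ne_zero b.factorial_ne_zero)
      refine (mul_eq_zero.1 ?_).resolve_left hne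
      rw [factorial_mul_complexEval_altWedge]
      refine Finset.sum_eq_zero fun σ _ => ?_
      -- Pigeonhole for each permutation: either the block of `α` receives more than `a - p` entries
      -- of `T` and the induction hypothesis applies, or every entry in the block of `β` lies in
      -- `T`.
      by_cases h1 : a < (∑ i, if Z (finSumFinEquiv (σ (Sum.inl i))) ∈ T then 1 else 0) + p
      · rw [ih hα _ h1, zero_mul, mul_zero]
      · have h2 : ∀ j, Z (finSumFinEquiv (σ (Sum.inr j))) ∈ T := by
          have hsplit : (∑ j, if Z j ∈ T then 1 else 0) =
              (∑ i, if Z (finSumFinEquiv (σ (Sum.inl i))) ∈ T then 1 else 0) +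
                ∑ j, if Z (finSumFinEquiv (σ (Sum.inr j))) ∈ T then 1 else 0 := by
            rw [← Equiv.sum_comp (σ.trans finSumFinEquiv), Fintype.sum_sum_type]
            rfl
          rw [hsplit] at h
          by_contra! h3
          obtain ⟨j₀, hj₀⟩ := h3
          have h4 : (∑ j, if Z (finSumFinEquiv (σ (Sum.inr j))) ∈ T then 1 else 0) <
              ∑ _j : Fin b, 1 :=
            Finset.sum_lt_sum (fun j _ => by split_ifs <;> simp)
              ⟨j₀, Finset.mem_univ _, by simp [hj₀]⟩
          simp only [Finset.sum_const, Finset.card_univ, Fintype.card_fin, smul_eq_mul,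
            mul_one] at h4
          omega
        rw [hβ _ h2, mul_zero, mul_zero]

/-- Only the first vector has an imaginary part, so every subset other than `∅` and `{0}` puts a
zero vector into `α`. -/
theorem complexEval_cons {p : ℕ} (α : E [⋀^Fin (p + 1)]→ₗ[ℝ] ℂ) (X Y : E) (w : Fin p → E) :
    complexEval α (Fin.cons (X, Y) fun i => (w i, 0)) =
      α (Fin.cons X w) + Complex.I * α (Fin.cons Y w) := by
  have hsub : ({∅, {0}} : Finset (Finset (Fin (p + 1)))) ⊆ Finset.univ := Finset.subset_univ _
  rw [complexEval, ← Finset.sum_subset hsub, Finset.sum_pair (Finset.singleton_ne_empty _).symm]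
  · have h1 : (fun j : Fin (p + 1) => if j ∈ (∅ : Finset (Fin (p + 1))) then
        ((Fin.cons (X, Y) fun i => (w i, 0) : Fin (p + 1) → E × E) j).2 else
        ((Fin.cons (X, Y) fun i => (w i, 0) : Fin (p + 1) → E × E) j).1) = Fin.cons X w := by
      funext j
      refine Fin.cases ?_ (fun j => ?_) j <;> simp
    have h2 : (fun j : Fin (p + 1) => if j ∈ ({0} : Finset (Fin (p + 1))) then
        ((Fin.cons (X, Y) fun i => (w i, 0) : Fin (p + 1) → E × E) j).2 else
        ((Fin.cons (X, Y) fun i => (w i, 0) : Fin (p + 1) → E × E) j).1) = Fin.cons Y w := by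
      funext j
      refine Fin.cases ?_ (fun j => ?_) j <;> simp
    rw [h1, h2]
    simp
  · intro t _ ht
    obtain ⟨i, hi⟩ : ∃ i : Fin p, i.succ ∈ t := by
      by_contra! h
      apply ht
      simp only [Finset.mem_insert, Finset.mem_singleton]
      by_cases h0 : (0 : Fin (p + 1)) ∈ t
      · right
        ext j
        refine Fin.cases ?_ (fun j => ?_) j
        · simp [h0]
        · simp [h j]
      · left
        ext j
        refine Fin.cases ?_ (fun j => ?_) j
        · simp [h0]
        · simp [h j]
    rw [α.map_coord_zero i.succ (by simp [hi]), mul_zero]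

/-- Forms of degree `p + 1` in the `(p + 1)`-st power of the ideal are annihilated by `T`. -/
theorem cons_add_I_mul_cons_of_mem_idealPow {T : Set (E × E)} {p : ℕ}
    {α : E [⋀^Fin (p + 1)]→ₗ[ℝ] ℂ} (hα : α ∈ idealPow T (p + 1) (p + 1)) {Z : E × E} (hZ : Z ∈ T)
    (w : Fin p → E) : α (Fin.cons Z.1 w) + Complex.I * α (Fin.cons Z.2 w) = 0 := by
  classical
  rw [← complexEval_cons]
  -- In degree equal to the exponent, a single entry in `T` is enough: `p + 1 < 1 + (p + 1)`.
  refine complexEval_eq_zero_of_mem_idealPow hα _ ?_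
  have h : (Fin.cons (Z.1, Z.2) fun i => (w i, 0) : Fin (p + 1) → E × E) 0 ∈ T := hZ
  rw [Fin.sum_univ_succ, if_pos h]
  omega

theorem alternatingMap_sum_apply {m : ℕ} {κ : Type*} (s : Finset κ) (α : κ → E [⋀^Fin m]→ₗ[ℝ] ℂ)
    (v : Fin m → E) : (∑ j ∈ s, α j) v = ∑ j ∈ s, α j v :=
  map_sum (⟨⟨fun β : E [⋀^Fin m]→ₗ[ℝ] ℂ => β v, rfl⟩, fun _ _ => rfl⟩ :
    (E [⋀^Fin m]→ₗ[ℝ] ℂ) →+ ℂ) α s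

/-- A real linear form `l` minus its part of type `(0,1)`. -/
def correctedForm (q₁ q₂ : E →ₗ[ℝ] E) (l : E →ₗ[ℝ] ℝ) : E →ₗ[ℝ] ℂ :=
  Complex.ofRealCLM.toLinearMap ∘ₗ (l - l ∘ₗ q₁) -
    Complex.I • (Complex.ofRealCLM.toLinearMap ∘ₗ (l ∘ₗ q₂))

theorem correctedForm_apply (q₁ q₂ : E →ₗ[ℝ] E) (l : E →ₗ[ℝ] ℝ) (v : E) :
    correctedForm q₁ q₂ l v = ((l v - l (q₁ v) : ℝ) : ℂ) - Complex.I * (l (q₂ v) : ℝ) := rfl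

/-- The hypotheses say that the complex linear map `Q = q₁ + i q₂` fixes `T`. The complex extension
of the corrected form is `l - l ∘ Q`, which therefore vanishes there. -/
theorem correctedForm_mem_vanishingForms {T : Set (E × E)} {q₁ q₂ : E →ₗ[ℝ] E}
    (h₁ : ∀ Z ∈ T, q₁ Z.1 - q₂ Z.2 = Z.1) (h₂ : ∀ Z ∈ T, q₂ Z.1 + q₁ Z.2 = Z.2)
    (l : E →ₗ[ℝ] ℝ) :
    AlternatingMap.ofSubsingleton ℝ E ℂ (0 : Fin 1) (correctedForm q₁ q₂ l) ∈
      vanishingForms T 1 := by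
  intro Z hZ
  have e : Z = Fin.cons ((Z 0).1, (Z 0).2) fun i : Fin 0 => ((i.elim0 : E), (0 : E)) := by
    funext j
    fin_cases j
    rfl
  have hl (z w : E) (h : z = w) : l z = l w := congrArg l h
  have e₁ := hl _ _ (h₁ _ (hZ 0))
  have e₂ := hl _ _ (h₂ _ (hZ 0))
  rw [map_sub] at e₁
  rw [map_add] at e₂
  rw [e, complexEval_cons]
  simp only [AlternatingMap.ofSubsingleton_apply_apply, Fin.cons_zero, correctedForm_apply, ← e₁,
    ← e₂]
  push_cast
  linear_combination (-(l (q₂ (Z 0).2) : ℂ)) * Complex.I_mul_I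

/-- With `Q = q₁ + i q₂`, the sum is `α(v, w) - α(Q v, w)` by expansion in the basis, and `α`
annihilates `Q v ∈ T`. Thus `α` is recovered from its contractions and forms of the ideal alone. -/
theorem sum_correctedForm_mul [FiniteDimensional ℝ E] {T : Set (E × E)} {q₁ q₂ : E →ₗ[ℝ] E}
    (hq : ∀ v, (q₁ v, q₂ v) ∈ T) {p : ℕ} {α : E [⋀^Fin (p + 1)]→ₗ[ℝ] ℂ}
    (hα : ∀ Z ∈ T, ∀ (v : Fin (p + 1) → E) (i : Fin (p + 1)),
      α (Function.update v i Z.1) + Complex.I * α (Function.update v i Z.2) = 0)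
    (v : E) (w : Fin p → E) :
    ∑ j, α (Fin.cons (Module.finBasis ℝ E j) w) *
      correctedForm q₁ q₂ ((Module.finBasis ℝ E).coord j) v = α (Fin.cons v w) := by
  have hsum (u : E) : ∑ j, α (Fin.cons (Module.finBasis ℝ E j) w) *
      (((Module.finBasis ℝ E).coord j u : ℝ) : ℂ) = α (Fin.cons u w) := by
    have h1 : α.curryLeft u w = α (Fin.cons u w) := rfl
    rw [← h1]
    conv_rhs => rw [← (Module.finBasis ℝ E).sum_repr u]
    rw [map_sum, alternatingMap_sum_apply]
    refine Finset.sum_congr rfl fun j _ => ?_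
    rw [map_smul, AlternatingMap.smul_apply, Complex.real_smul, mul_comm]
    rfl
  have h0 := hα _ (hq v) (Fin.cons v w) 0
  simp only [Fin.update_cons_zero] at h0
  simp only [correctedForm_apply]
  have h2 : ∀ j, α (Fin.cons (Module.finBasis ℝ E j) w) *
      ((((Module.finBasis ℝ E).coord j v - (Module.finBasis ℝ E).coord j (q₁ v) : ℝ) : ℂ) -
        Complex.I * ((Module.finBasis ℝ E).coord j (q₂ v) : ℝ)) =
      α (Fin.cons (Module.finBasis ℝ E j) w) * (((Module.finBasis ℝ E).coord j v : ℝ) : ℂ) -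
      (α (Fin.cons (Module.finBasis ℝ E j) w) * (((Module.finBasis ℝ E).coord j (q₁ v) : ℝ) : ℂ) +
      Complex.I * (α (Fin.cons (Module.finBasis ℝ E j) w) *
        (((Module.finBasis ℝ E).coord j (q₂ v) : ℝ) : ℂ))) := by
    intro j
    push_cast
    ring
  rw [Finset.sum_congr rfl fun j _ => h2 j, Finset.sum_sub_distrib, Finset.sum_add_distrib,
    ← Finset.mul_sum, hsum, hsum, hsum, h0, sub_zero]

/-- Moving the last index to the front. -/
def lastToFront (p : ℕ) : Fin (p + 1) ≃ Fin p ⊕ Fin 1 where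
  toFun := Fin.cons (Sum.inr 0) fun i => Sum.inl i
  invFun := Sum.elim Fin.succ fun _ => 0
  left_inv i := by refine Fin.cases ?_ (fun i => ?_) i <;> simp
  right_inv i := by
    rcases i with i | i
    · simp
    · fin_cases i
      rfl

/-- A form of degree `p` annihilated by `T` lies in the `p`-th power of the ideal, if there is a
complex linear projection `q₁ + i q₂` onto `T`. -/
theorem mem_idealPow_of_annihilated [FiniteDimensional ℝ E] {T : Set (E × E)} {q₁ q₂ : E →ₗ[ℝ] E}
    (hq : ∀ v, (q₁ v, q₂ v) ∈ T) (h₁ : ∀ Z ∈ T, q₁ Z.1 - q₂ Z.2 = Z.1)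
    (h₂ : ∀ Z ∈ T, q₂ Z.1 + q₁ Z.2 = Z.2) {p : ℕ} :
    ∀ {α : E [⋀^Fin p]→ₗ[ℝ] ℂ}, (∀ Z ∈ T, ∀ (v : Fin p → E) (i : Fin p),
      α (Function.update v i Z.1) + Complex.I * α (Function.update v i Z.2) = 0) →
      α ∈ idealPow T p p := by
  induction p with
  | zero => exact fun _ => Submodule.mem_top
  | succ p ih =>
    intro α hα
    let ξ (j : Fin (Module.finrank ℝ E)) : E [⋀^Fin (p + 1)]→ₗ[ℝ] ℂ :=
      altWedge (α.curryLeft (Module.finBasis ℝ E j)) (AlternatingMap.ofSubsingleton ℝ E ℂ (0 : Fin 1)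
        (correctedForm q₁ q₂ ((Module.finBasis ℝ E).coord j)))
    have hξ : ∑ j, ξ j ∈ idealPow T (p + 1) (p + 1) := by
      refine Submodule.sum_mem _ fun j _ => Submodule.subset_span ?_
      refine ⟨p, 1, rfl, _, ih fun Z hZ v i => ?_, _,
        correctedForm_mem_vanishingForms h₁ h₂ ((Module.finBasis ℝ E).coord j), rfl⟩
      have h := hα Z hZ (Fin.cons (Module.finBasis ℝ E j) v) i.succ
      rw [← Fin.cons_update, ← Fin.cons_update] at h
      exact h
    -- `curryLeft` takes out the first argument of `α`, whereas `altWedge` feeds the last one to the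
    -- linear form; `ε` is the sign of that shift.
    let ε : ℤˣ := Equiv.Perm.sign ((lastToFront p).trans finSumFinEquiv)
    have key : ∀ v, (p.factorial : ℂ) * (∑ j, ξ j) v =
        ((p + 1).factorial : ℂ) * (((ε : ℤ) : ℂ) * α v) := by
      intro v
      let A (j : Fin (Module.finrank ℝ E)) (σ : Equiv.Perm (Fin p ⊕ Fin 1)) : ℂ :=
        ((Equiv.Perm.sign σ : ℤ) : ℂ) *
          (α.curryLeft (Module.finBasis ℝ E j) (fun i => v (finSumFinEquiv (σ (Sum.inl i)))) *
          AlternatingMap.ofSubsingleton ℝ E ℂ (0 : Fin 1)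
            (correctedForm q₁ q₂ ((Module.finBasis ℝ E).coord j))
            (fun j => v (finSumFinEquiv (σ (Sum.inr j)))))
      have h3 : ∀ j, (p.factorial : ℂ) * ξ j v = ∑ σ, A j σ := fun j => by
        have := factorial_mul_altWedge (α.curryLeft (Module.finBasis ℝ E j))
          (AlternatingMap.ofSubsingleton ℝ E ℂ (0 : Fin 1)
            (correctedForm q₁ q₂ ((Module.finBasis ℝ E).coord j))) v
        rwa [Nat.factorial_one, mul_one] at this
      rw [alternatingMap_sum_apply, Finset.mul_sum, Finset.sum_congr rfl fun j _ => h3 j,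
        Finset.sum_comm]
      -- Summed over the basis, the term of `σ` is `sign σ` times `α` on permuted arguments. The
      -- sign occurs twice and cancels, so all `(p + 1)!` permutations contribute equally.
      have h4 : ∀ σ : Equiv.Perm (Fin p ⊕ Fin 1), ∑ j, A j σ = ((ε : ℤ) : ℂ) * α v := by
        intro σ
        rw [← Finset.mul_sum]
        have h5 := sum_correctedForm_mul hq hα (v (finSumFinEquiv (σ (Sum.inr 0))))
          (fun i => v (finSumFinEquiv (σ (Sum.inl i))))
        refine (congrArg _ h5).trans ?_
        let π : Equiv.Perm (Fin (p + 1)) :=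
          ((lastToFront p).trans finSumFinEquiv).trans
            ((finSumFinEquiv.symm.trans σ).trans finSumFinEquiv)
        have h6 : (Fin.cons (v (finSumFinEquiv (σ (Sum.inr 0))))
            (fun i => v (finSumFinEquiv (σ (Sum.inl i)))) : Fin (p + 1) → E) = v ∘ π := by
          funext i
          refine Fin.cases ?_ (fun i => ?_) i <;> simp [π, lastToFront]
        have h7 : Equiv.Perm.sign π = Equiv.Perm.sign σ * ε := by
          rw [Equiv.Perm.sign_trans, Equiv.Perm.sign_symm_trans_trans]
        rw [h6, AlternatingMap.map_perm, h7, Units.smul_def, zsmul_eq_mul, ← mul_assoc,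
          Units.val_mul, Int.cast_mul, ← mul_assoc]
        have h8 : ((Equiv.Perm.sign σ : ℤ) : ℂ) * ((Equiv.Perm.sign σ : ℤ) : ℂ) = 1 := by
          rw [← Int.cast_mul, ← Units.val_mul, Int.units_mul_self]
          simp
        rw [h8, one_mul]
      rw [Finset.sum_congr rfl fun σ _ => h4 σ, Finset.sum_const, nsmul_eq_mul, Finset.card_univ,
        Fintype.card_perm]
      simp
    have hε : ((ε : ℤ) : ℂ) ≠ 0 := by exact_mod_cast ε.ne_zero
    have hf : ((p + 1).factorial : ℂ) ≠ 0 := Nat.cast_ne_zero.2 (p + 1).factorial_ne_zero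
    have hα' : α = ((((p + 1).factorial : ℂ) * ((ε : ℤ) : ℂ))⁻¹ * (p.factorial : ℂ)) • ∑ j, ξ j := by
      ext v
      rw [AlternatingMap.smul_apply, smul_eq_mul, mul_assoc, key, ← mul_assoc _ _ (α v),
        ← mul_assoc, inv_mul_cancel₀ (mul_ne_zero hf hε), one_mul]
    rw [hα']
    exact Submodule.smul_mem _ _ hξ

/-- The projection onto the graph of a complex structure on a subspace. -/
theorem exists_projection {F : Type*} [AddCommGroup F] [Module ℝ F] {L : E →ₗ[ℝ] F}
    (hL : Function.Injective L) {H : Submodule ℝ F} {J : H →ₗ[ℝ] H} (hJ : ∀ v, J (J v) = -v)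
    {K : Submodule ℝ F} (hKH : K ≤ H) (hKL : K ≤ LinearMap.range L)
    (hJK : ∀ h : H, (h : F) ∈ K → (J h : F) ∈ K) :
    ∃ q₁ q₂ : E →ₗ[ℝ] E,
      (∀ v, ∃ h : H, (h : F) ∈ K ∧ L (q₁ v) = h ∧ L (q₂ v) = J h) ∧
      ∀ X Y : E, (∃ h : H, (h : F) ∈ K ∧ L X = h ∧ L Y = J h) →
        q₁ X - q₂ Y = X ∧ q₂ X + q₁ Y = Y := by
  obtain ⟨R, hR⟩ := L.exists_leftInverse_of_injective (LinearMap.ker_eq_bot.2 hL)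
  obtain ⟨π, hπ⟩ := K.subtype.exists_leftInverse_of_injective K.ker_subtype
  have hR' : ∀ v, R (L v) = v := LinearMap.congr_fun hR
  have hπ' : ∀ v : K, π v = v := LinearMap.congr_fun hπ
  have hLR : ∀ k ∈ K, L (R k) = k := by
    intro k hk
    obtain ⟨u, rfl⟩ := hKL hk
    rw [hR']
  let i : K →ₗ[ℝ] H := Submodule.inclusion hKH
  -- With `π` a real projection onto `K`, the map is `v ↦ (π v + i J π v) / 2`. The factor `1/2`
  -- makes it fix `h + i J h`, where the real part `h` and the imaginary part `J h` contribute
  -- equally.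
  let q₁ : E →ₗ[ℝ] E := (1 / 2 : ℝ) • (R ∘ₗ H.subtype ∘ₗ i ∘ₗ π ∘ₗ L)
  let q₂ : E →ₗ[ℝ] E := (1 / 2 : ℝ) • (R ∘ₗ H.subtype ∘ₗ J ∘ₗ i ∘ₗ π ∘ₗ L)
  have e₁ : ∀ v, q₁ v = (1 / 2 : ℝ) • R (i (π (L v))) := fun v => rfl
  have e₂ : ∀ v, q₂ v = (1 / 2 : ℝ) • R (J (i (π (L v)))) := fun v => rfl
  refine ⟨q₁, q₂, fun v => ⟨(1 / 2 : ℝ) • i (π (L v)), ?_, ?_, ?_⟩, ?_⟩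
  · exact K.smul_mem _ (π (L v)).2
  · rw [e₁, map_smul]
    exact congrArg _ (hLR _ (π (L v)).2)
  · rw [e₂, map_smul, map_smul]
    exact congrArg _ (hLR _ (hJK _ (π (L v)).2))
  · rintro X Y ⟨h, hK, hX, hY⟩
    have a₁ : i (π (L X)) = h := by
      have := hπ' ⟨h, hK⟩
      rw [hX, show π (h : F) = ⟨h, hK⟩ from this]
      rfl
    have a₂ : i (π (L Y)) = J h := by
      have := hπ' ⟨J h, hJK h hK⟩
      rw [hY, show π (J h : F) = ⟨J h, hJK h hK⟩ from this]
      rfl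
    have b₁ : R (h : F) = X := by rw [← hX, hR']
    have b₂ : R (J h : F) = Y := by rw [← hY, hR']
    rw [e₁, e₁, e₂, e₂, a₁, a₂, hJ, Submodule.coe_neg, map_neg, b₁, b₂]
    constructor <;> module

end IdealPowers

/-! ### Restriction to the submanifold: closedness and independence of choices. -/

section Restriction

open Filter

variable {m : ℕ} {M : Type*} [TopologicalSpace M] [ChartedSpace (RModel m) M]
  [IsManifold 𝓘(ℝ, RModel m) ∞ M]
  {m' : ℕ} {N : Type*} [TopologicalSpace N] [ChartedSpace (RModel m') N]
  [IsManifold 𝓘(ℝ, RModel m') ∞ N] {p : ℕ}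

/-- A smooth immersion has a smooth local left inverse. -/
theorem exists_local_retraction {ι : N → M} {y : N}
    (h : IsImmersionAt 𝓘(ℝ, RModel m') 𝓘(ℝ, RModel m) ∞ ι y) :
    ∃ g : M → N, ContMDiffAt 𝓘(ℝ, RModel m) 𝓘(ℝ, RModel m') ∞ g (ι y) ∧
      ∀ᶠ y' in 𝓝 y, g (ι y') = y' := by
  -- In adapted charts the immersion is `u ↦ (u, 0)`; the retraction is the projection onto the
  -- first factor.
  have hw : ∀ y' ∈ h.domChart.source, h.codChart (ι y') = h.equiv (h.domChart y', 0) := by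
    intro y' hy'
    have hm : h.domChart y' ∈ (h.domChart.extend 𝓘(ℝ, RModel m')).target := by
      simpa using h.domChart.map_source hy'
    have hz := h.writtenInCharts hm
    simpa [h.domChart.left_inv hy'] using hz
  have hr : ∀ y' ∈ h.domChart.source, (h.equiv.symm (h.codChart (ι y'))).1 = h.domChart y' := by
    intro y' hy'
    rw [hw y' hy', ContinuousLinearEquiv.symm_apply_apply]
  refine ⟨fun x => h.domChart.symm ((h.equiv.symm (h.codChart x)).1), ?_, ?_⟩
  · have h1 : ContMDiffAt 𝓘(ℝ, RModel m) 𝓘(ℝ, RModel m) ∞ h.codChart (ι y) :=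
      contMDiffAt_of_mem_maximalAtlas h.codChart_mem_maximalAtlas h.mem_codChart_source
    have h2 : ContMDiff 𝓘(ℝ, RModel m) 𝓘(ℝ, RModel m') ∞
        ((ContinuousLinearMap.fst ℝ (RModel m') h.complement).comp
          (h.equiv.symm : RModel m →L[ℝ] RModel m' × h.complement)) :=
      ContinuousLinearMap.contMDiff _
    have h3 := h2.contMDiffAt.comp (ι y) h1
    refine ContMDiffAt.comp (ι y) (g := h.domChart.symm) ?_ h3
    refine contMDiffAt_symm_of_mem_maximalAtlas h.domChart_mem_maximalAtlas ?_
    have e := hr y h.mem_domChart_source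
    exact e ▸ h.domChart.map_source h.mem_domChart_source
  · filter_upwards [h.domChart.open_source.mem_nhds h.mem_domChart_source] with y' hy'
    rw [hr y' hy', h.domChart.left_inv hy']

/-- The derivative of a local retraction is a left inverse. -/
theorem modelDeriv_injective {ι : N → M}
    (h : IsSmoothEmbedding 𝓘(ℝ, RModel m') 𝓘(ℝ, RModel m) ∞ ι) (y : N) :
    Function.Injective (modelDeriv ι y : RModel m' →L[ℝ] RModel m) := by
  obtain ⟨g, hg, hgι⟩ := exists_local_retraction (h.isImmersion.isImmersionAt y)
  have h1 := mfderiv_comp y (hg.mdifferentiableAt (by simp)) (h.contMDiff.mdifferentiable (by simp) y)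
  have h2 : (g ∘ ι) =ᶠ[𝓝 y] id := hgι
  rw [h2.mfderiv_eq, mfderiv_id] at h1
  refine Function.LeftInverse.injective (g := (modelDeriv g (ι y) : RModel m →L[ℝ] RModel m'))
    fun v => ?_
  exact (congrArg (fun A : RModel m' →L[ℝ] RModel m' => A v) h1).symm

variable {ι : N → M} {U : Set M} {s : M → ℂ}

/-- `s ∘ ι` vanishes near `y`, so `ds` kills the vectors tangent to `S`. -/
theorem IsDefiningFunction.modelDfun_comp (hs : IsDefiningFunction m (range ι) U s)
    (hι : ContMDiff 𝓘(ℝ, RModel m') 𝓘(ℝ, RModel m) ∞ ι) {y : N} (hy : ι y ∈ U) (w : RModel m') :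
    (modelDfun s (ι y) : RModel m →L[ℝ] ℂ) ((modelDeriv ι y : RModel m' →L[ℝ] RModel m) w) = 0 := by
  have h1 := mfderiv_comp y ((hs.contMDiffAt _ hy).mdifferentiableAt (by simp))
    (hι.mdifferentiable (by simp) y)
  have h2 : (s ∘ ι) =ᶠ[𝓝 y] fun _ => (0 : ℂ) := by
    filter_upwards [hι.continuous.continuousAt (hs.isOpen.mem_nhds hy)] with y' hy'
    exact (hs.zero_iff _ hy').2 (mem_range_self y')
  rw [h2.mfderiv_eq, mfderiv_const] at h1
  exact (congrArg (fun A : RModel m' →L[ℝ] ℂ => A w) h1).symm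

/-- The pullback is recovered from `ds ∧ ψ`. -/
theorem IsDefiningFunction.dfunWedge_cons (hs : IsDefiningFunction m (range ι) U s)
    (hι : ContMDiff 𝓘(ℝ, RModel m') 𝓘(ℝ, RModel m) ∞ ι) {y : N} (hy : ι y ∈ U)
    (ψ : DForm m M p) (v : RModel m) (w : Fin p → RModel m') :
    oneWedge (modelDfun s (ι y)) (ψ (ι y))
      (Fin.cons v fun i => (modelDeriv ι y : RModel m' →L[ℝ] RModel m) (w i)) =
    (modelDfun s (ι y) : RModel m →L[ℝ] ℂ) v *
      formPull (ψ (ι y)) (modelDeriv ι y : RModel m' →L[ℝ] RModel m) w :=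
  oneWedge_cons _ _ _ _ fun i => hs.modelDfun_comp hι hy (w i)

variable {φ θ : DForm m M (p + 1)} {ψ : DForm m M p}

theorem DForm.SmoothOn.pullback (hι : ContMDiff 𝓘(ℝ, RModel m') 𝓘(ℝ, RModel m) ∞ ι)
    (hU : IsOpen U) (hψ : ψ.SmoothOn U) :
    (DForm.pullback ι ψ : DForm m' N p).SmoothOn (ι ⁻¹' U) := by
  rw [DForm.smoothOn_iff hU] at hψ
  rw [DForm.smoothOn_iff (hU.preimage hι.continuous)]
  exact fun y hy => (hψ _ hy).pullback hι

/-- Evaluate `ds ∧ dψ = 0` on one vector `v` with `ds(v) ≠ 0` followed by tangent vectors of `S`: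
what remains is `ds(v)` times the pullback of `dψ`. -/
theorem IsDefiningFunction.d_pullback_eq_zero (hs : IsDefiningFunction m (range ι) U s)
    (hι : ContMDiff 𝓘(ℝ, RModel m') 𝓘(ℝ, RModel m) ∞ ι) (hS : IsClosed (range ι))
    (hφ : φ.SmoothOn (range ι)ᶜ) (hdφ : ∀ x ∈ (range ι)ᶜ, φ.d x = 0) (hψ : ψ.SmoothOn U)
    (hθ : θ.SmoothOn U)
    (hdec : ∀ x ∈ U \ range ι, φ x = (s x)⁻¹ • DForm.dfunWedge s ψ x + θ x)
    {y : N} (hy : ι y ∈ U) : (DForm.pullback ι ψ : DForm m' N p).d y = 0 := by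
  obtain ⟨v, hv⟩ := DFunLike.ne_iff.1 (hs.differential_ne_zero _ hy)
  have h := hs.dfunWedge_d_eq_zero hS hφ hdφ hψ hθ hdec hy (mem_range_self y)
  rw [DForm.d_pullback hι ((DForm.smoothOn_iff hs.isOpen).1 hψ _ hy)]
  ext w
  have h1 := hs.dfunWedge_cons hι hy ψ.d v w
  have h2 := congrArg (fun β : RModel m [⋀^Fin (p + 2)]→L[ℝ] ℂ =>
    β (Fin.cons v fun i => (modelDeriv ι y : RModel m' →L[ℝ] RModel m) (w i))) h
  exact (mul_eq_zero.1 (h1.symm.trans h2)).resolve_left hv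

/-- For a common transversal vector `v`, evaluating the proportionality of the leading terms on `v`
and tangent vectors puts the factor `ds(v) ds'(v)` on both sides. -/
theorem IsDefiningFunction.pullback_eq (hs : IsDefiningFunction m (range ι) U s)
    (hι : ContMDiff 𝓘(ℝ, RModel m') 𝓘(ℝ, RModel m) ∞ ι) (hψ : ψ.SmoothOn U)
    (hθ : θ.SmoothOn U)
    (hdec : ∀ x ∈ U \ range ι, φ x = (s x)⁻¹ • DForm.dfunWedge s ψ x + θ x)
    {U' : Set M} {s' : M → ℂ} {θ' : DForm m M (p + 1)} {ψ' : DForm m M p}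
    (hs' : IsDefiningFunction m (range ι) U' s') (hψ' : ψ'.SmoothOn U') (hθ' : θ'.SmoothOn U')
    (hdec' : ∀ x ∈ U' \ range ι, φ x = (s' x)⁻¹ • DForm.dfunWedge s' ψ' x + θ' x)
    {y : N} (hy : ι y ∈ U) (hy' : ι y ∈ U') :
    (DForm.pullback ι ψ : DForm m' N p) y = DForm.pullback ι ψ' y := by
  obtain ⟨v, hv, hv'⟩ := exists_ne_zero_ne_zero (hs.differential_ne_zero _ hy)
    (hs'.differential_ne_zero _ hy')
  have h := hs.smul_dfunWedge_eq hψ hθ hdec hs' hψ' hθ' hdec' hy hy' (mem_range_self y) hv hv'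
  ext w
  have h1 := hs.dfunWedge_cons hι hy ψ v w
  have h1' := hs'.dfunWedge_cons hι hy' ψ' v w
  have h2 : (modelDfun s (ι y) : RModel m →L[ℝ] ℂ) v * oneWedge (modelDfun s' (ι y)) (ψ' (ι y))
      (Fin.cons v fun i => (modelDeriv ι y : RModel m' →L[ℝ] RModel m) (w i)) =
    (modelDfun s' (ι y) : RModel m →L[ℝ] ℂ) v * oneWedge (modelDfun s (ι y)) (ψ (ι y))
      (Fin.cons v fun i => (modelDeriv ι y : RModel m' →L[ℝ] RModel m) (w i)) :=
    congrArg (fun β : RModel m [⋀^Fin (p + 1)]→L[ℝ] ℂ =>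
      β (Fin.cons v fun i => (modelDeriv ι y : RModel m' →L[ℝ] RModel m) (w i))) h
  rw [h1, h1', mul_left_comm] at h2
  exact (mul_left_cancel₀ hv (mul_left_cancel₀ hv' h2)).symm

end Restriction

/-! ### Annihilation by smooth complex vector fields passes to the limit on `S`. -/

section Fields

open Filter

variable {m : ℕ} {M : Type*} [TopologicalSpace M] [ChartedSpace (RModel m) M]
  [IsManifold 𝓘(ℝ, RModel m) ∞ M] {p : ℕ}

/-- The coordinate expression of a vector field in the preferred chart at `x₀`. -/
def fieldCoord (A : ∀ x : M, TangentSpace 𝓘(ℝ, RModel m) x) (x₀ : M) : RModel m → RModel m :=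
  fun z => modelDeriv (chartAt (RModel m) x₀) ((chartAt (RModel m) x₀).symm z)
    (A ((chartAt (RModel m) x₀).symm z))

/-- On the chart domain, the trivialization of the tangent bundle at `x` is the derivative of the
chart at `x`, so `fieldCoord` is the fibre component of the section. -/
theorem SmoothFieldOn.continuousAt_fieldCoord {A : ∀ x : M, TangentSpace 𝓘(ℝ, RModel m) x}
    {W : Set M} (hA : SmoothFieldOn A W) (hW : IsOpen W) {x : M} (hx : x ∈ W) :
    ContinuousAt (fieldCoord A x) (chartAt (RModel m) x x) := by
  have hl := (chartAt (RModel m) x).left_inv (mem_chart_source _ x)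
  have : IsManifold 𝓘(ℝ, RModel m) 1 M := .of_le (n := ∞) (by simp)
  have h1 := ((Bundle.contMDiffAt_section x).1 (ContMDiffOn.contMDiffAt hA (hW.mem_nhds hx))).continuousAt
  have hc := (chartAt (RModel m) x).continuousAt_symm (mem_chart_target _ x)
  rw [← hl] at h1
  have h2 := ContinuousAt.comp (f := (chartAt (RModel m) x).symm) (x := chartAt (RModel m) x x) h1 hc
  rw [hl] at h2
  refine h2.congr ?_
  filter_upwards [(chartAt (RModel m) x).open_target.mem_nhds (mem_chart_target _ x)] with z hz
  have hs := (chartAt (RModel m) x).map_target hz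
  have h3 := TangentBundle.continuousLinearMapAt_trivializationAt (I := 𝓘(ℝ, RModel m)) hs
  have h4 := Bundle.Trivialization.continuousLinearMapAt_apply_of_mem (R := ℝ)
    (trivializationAt (RModel m) (TangentSpace 𝓘(ℝ, RModel m)) x)
    (b := (chartAt (RModel m) x).symm z) (by simpa using hs) (A ((chartAt (RModel m) x).symm z))
  rw [h3] at h4
  exact h4.symm

theorem DForm.inChart_cons_fieldCoord (η : DForm m M (p + 1))
    (A : ∀ x : M, TangentSpace 𝓘(ℝ, RModel m) x) (x₀ : M) {z : RModel m}
    (hz : z ∈ (chartAt (RModel m) x₀).target) {x : M} (h : (chartAt (RModel m) x₀).symm z = x)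
    (w : Fin p → RModel m) :
    η.inChart x₀ z (Fin.cons (fieldCoord A x₀ z) w) =
      (η x : RModel m [⋀^Fin (p + 1)]→L[ℝ] ℂ) (Fin.cons (A x : RModel m) fun i =>
        (modelDeriv (chartAt (RModel m) x₀).symm z : RModel m →L[ℝ] RModel m) (w i)) := by
  rw [DForm.inChart_of_symm_eq η h]
  refine congrArg (η x : RModel m [⋀^Fin (p + 1)]→L[ℝ] ℂ) ?_
  subst h
  funext i
  refine Fin.cases ?_ (fun i => rfl) i
  have hs := (chartAt (RModel m) x₀).map_target hz
  have := mfderiv_chartAt_symm_mfderiv_chartAt hs (A ((chartAt (RModel m) x₀).symm z))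
  rw [(chartAt (RModel m) x₀).right_inv hz] at this
  exact this

variable {S U : Set M} {s : M → ℂ} {φ θ : DForm m M (p + 1)} {ψ : DForm m M p}

/-- If `φ` annihilates `A + iB` off `S`, then so does `ds ∧ ψ` on `S`. -/
theorem IsDefiningFunction.dfunWedge_cons_eq_zero (hs : IsDefiningFunction m S U s)
    (hψ : ψ.SmoothOn U) (hθ : θ.SmoothOn U)
    (hdec : ∀ x ∈ U \ S, φ x = (s x)⁻¹ • DForm.dfunWedge s ψ x + θ x) {x : M} (hx : x ∈ U)
    (hxS : x ∈ S) {A B : ∀ x : M, TangentSpace 𝓘(ℝ, RModel m) x} {W : Set M} (hW : IsOpen W)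
    (hxW : x ∈ W) (hA : SmoothFieldOn A W) (hB : SmoothFieldOn B W)
    (hAB : ∀ x' ∈ W \ S, ∀ w : Fin p → RModel m,
      (φ x' : RModel m [⋀^Fin (p + 1)]→L[ℝ] ℂ) (Fin.cons (A x' : RModel m) w) +
        Complex.I * (φ x' : RModel m [⋀^Fin (p + 1)]→L[ℝ] ℂ) (Fin.cons (B x' : RModel m) w) = 0)
    (w : Fin p → RModel m) :
    oneWedge (modelDfun s x) (ψ x) (Fin.cons (A x : RModel m) w) +
      Complex.I * oneWedge (modelDfun s x) (ψ x) (Fin.cons (B x : RModel m) w) = 0 := by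
  have hsx := hs.contMDiffAt x hx
  have hsrc := mem_chart_source (RModel m) x
  have hl := (chartAt (RModel m) x).left_inv hsrc
  have htg := mem_chart_target (RModel m) x
  have hf := (hsx.coordFun hsrc).differentiableAt (n := ∞) (by simp)
  have hf0 : (coordFun s x : RModel m → ℂ) (chartAt (RModel m) x x) = 0 :=
    hs.coordFun_eq_zero hx hxS
  obtain ⟨v, hv⟩ := DFunLike.ne_iff.1 (hs.differential_ne_zero x hx)
  change (modelDfun s x : RModel m →L[ℝ] ℂ) v ≠ 0 at hv
  rw [← fderiv_coordFun_modelDeriv (hsx.mdifferentiableAt (by simp))] at hv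
  have hγ := tendsto_line (chartAt (RModel m) x x)
    (modelDeriv (chartAt (RModel m) x) x v : RModel m)
  have hne := eventually_ne_zero_line hf hf0 hv
  have h1 := hs.tendsto_smul hψ hθ hdec hx hxS hγ hne
  set u : Fin p → RModel m := fun i =>
    (modelDeriv (chartAt (RModel m) x) x : RModel m →L[ℝ] RModel m) (w i) with hu
  -- The first argument follows the field along the line, while the others are kept constant in the
  -- chart. The limit then involves only `s φ` and the two fields.
  have hcons : ∀ C : ∀ x : M, TangentSpace 𝓘(ℝ, RModel m) x, SmoothFieldOn C W →
      Tendsto (fun t : ℝ => (Fin.cons (fieldCoord C x (chartAt (RModel m) x x +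
        t • (modelDeriv (chartAt (RModel m) x) x v : RModel m))) u : Fin (p + 1) → RModel m))
        (𝓝[≠] 0) (𝓝 (Fin.cons (fieldCoord C x (chartAt (RModel m) x x)) u)) := by
    intro C hC
    refine tendsto_pi_nhds.2 fun i => Fin.cases ?_ (fun i => tendsto_const_nhds) i
    exact (hC.continuousAt_fieldCoord hW hxW).tendsto.comp hγ
  have h2 := (h1.eval (hcons A hA)).add ((h1.eval (hcons B hB)).const_mul Complex.I)
  have hval : ∀ C : ∀ x : M, TangentSpace 𝓘(ℝ, RModel m) x,
      (DForm.dfunWedge s ψ).inChart x (chartAt (RModel m) x x)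
        (Fin.cons (fieldCoord C x (chartAt (RModel m) x x)) u) =
      oneWedge (modelDfun s x) (ψ x) (Fin.cons (C x : RModel m) w) := by
    intro C
    rw [DForm.inChart_cons_fieldCoord _ C x htg hl]
    have : (fun i => (modelDeriv (chartAt (RModel m) x).symm (chartAt (RModel m) x x) :
        RModel m →L[ℝ] RModel m) (u i)) = w := by
      funext i
      exact mfderiv_chartAt_symm_mfderiv_chartAt hsrc (w i)
    rw [this]
    rfl
  rw [hval, hval] at h2
  refine tendsto_nhds_unique h2 (tendsto_const_nhds.congr' ?_)
  filter_upwards [hne, hγ.eventually (eventually_chartAt_symm (hs.isOpen.mem_nhds hx)),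
    hγ.eventually (eventually_chartAt_symm (hW.mem_nhds hxW)),
    hγ.eventually ((chartAt (RModel m) x).open_target.mem_nhds htg)] with t ht0 htU htW ht
  have hS' := fun h => ht0 ((hs.zero_iff _ htU).2 h)
  rw [ContinuousAlternatingMap.smul_apply, ContinuousAlternatingMap.smul_apply,
    DForm.inChart_cons_fieldCoord _ A x ht rfl, DForm.inChart_cons_fieldCoord _ B x ht rfl,
    smul_eq_mul, smul_eq_mul, mul_left_comm, ← mul_add, hAB _ ⟨htW, hS'⟩, mul_zero]

end Fields

/-! ### Pointwise algebra: from `α ∧ β` to the restriction of `β`. -/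

section Algebra

variable {E : Type*} [NormedAddCommGroup E] [NormedSpace ℝ E] {p : ℕ}

/-- If `α ∧ β` annihilates a complex vector in the kernel of `α`, then so does `β`, on vectors
in the kernel of `α`. -/
theorem cons_add_I_mul_cons_of_oneWedge {α : E →L[ℝ] ℂ} {β : E [⋀^Fin (p + 1)]→L[ℝ] ℂ} {X Y v : E}
    (hX : α X = 0) (hY : α Y = 0) (hv : α v ≠ 0)
    (h : ∀ w, oneWedge α β (Fin.cons X w) + Complex.I * oneWedge α β (Fin.cons Y w) = 0)
    {w : Fin p → E} (hw : ∀ i, α (w i) = 0) :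
    β (Fin.cons X w) + Complex.I * β (Fin.cons Y w) = 0 := by
  -- Among the arguments `Z, v, w` only `v` is not killed by `α`; bringing it to the front past `Z`
  -- costs the sign.
  have key : ∀ Z, α Z = 0 → oneWedge α β (Fin.cons Z (Fin.cons v w)) =
      -(α v * β (Fin.cons Z w)) := by
    intro Z hZ
    have h1 := congrArg (fun η : E [⋀^Fin (p + 1)]→L[ℝ] ℂ => η (Fin.cons v w))
      (curryLeft_oneWedge α β Z)
    have h2 : oneWedge α β (Fin.cons Z (Fin.cons v w)) =
      α Z * β (Fin.cons v w) - oneWedge α (β.curryLeft Z) (Fin.cons v w) := h1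
    rw [h2, oneWedge_cons _ _ _ _ hw, hZ, zero_mul, zero_sub]
    rfl
  have h3 := h (Fin.cons v w)
  rw [key X hX, key Y hY] at h3
  have h4 : α v * (β (Fin.cons X w) + Complex.I * β (Fin.cons Y w)) = 0 := by
    linear_combination -h3
  exact (mul_eq_zero.1 h4).resolve_left hv

/-- Moving slot `i` to the front multiplies both terms by the same sign, so testing the first slot
is enough. -/
theorem update_add_I_mul_update {F : Type*} [AddCommGroup F] [Module ℝ F]
    (β : F [⋀^Fin (p + 1)]→ₗ[ℝ] ℂ) (X Y : F)
    (h : ∀ w, β (Fin.cons X w) + Complex.I * β (Fin.cons Y w) = 0) (v : Fin (p + 1) → F)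
    (i : Fin (p + 1)) :
    β (Function.update v i X) + Complex.I * β (Function.update v i Y) = 0 := by
  have key : ∀ Z, β (Function.update v i Z) = (-1) ^ (i : ℕ) • β (Fin.cons Z (i.removeNth v)) := by
    intro Z
    rw [← Fin.insertNth_removeNth, AlternatingMap.map_insertNth]
    rfl
  rw [key, key, mul_smul_comm, ← smul_add, h, smul_zero]

/-- If `α ∧ β` annihilates the complex vectors `X + iJX`, then the restriction of `β` to a subspace
in the kernel of `α` lies in the power of the ideal of forms annihilating those in the subspace. -/
theorem comp_mem_idealPow_of_oneWedge {F : Type*} [NormedAddCommGroup F] [NormedSpace ℝ F]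
    [FiniteDimensional ℝ E] {D : E →L[ℝ] F} (hD : Function.Injective D) {α : F →L[ℝ] ℂ} {v : F}
    (hv : α v ≠ 0) (hαD : ∀ w, α (D w) = 0) {H : Submodule ℝ F} {J : H →ₗ[ℝ] H}
    (hJ : ∀ v, J (J v) = -v) {K : Submodule ℝ F} (hKH : K ≤ H)
    (hKD : K ≤ LinearMap.range D.toLinearMap) (hJK : ∀ h : H, (h : F) ∈ K → (J h : F) ∈ K)
    {p : ℕ} {β : F [⋀^Fin p]→L[ℝ] ℂ}
    (h : ∀ (h : H) (w : Fin p → F), oneWedge α β (Fin.cons (h : F) w) +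
      Complex.I * oneWedge α β (Fin.cons (J h : F) w) = 0) :
    (β.compContinuousLinearMap D).toAlternatingMap ∈
      idealPow {Z : E × E | ∃ h : H, (h : F) ∈ K ∧ D Z.1 = h ∧ D Z.2 = J h} p p := by
  obtain ⟨q₁, q₂, hq, hT⟩ := exists_projection (L := D.toLinearMap) hD hJ hKH hKD hJK
  refine mem_idealPow_of_annihilated (q₁ := q₁) (q₂ := q₂) hq
    (fun Z hZ => (hT Z.1 Z.2 hZ).1) (fun Z hZ => (hT Z.1 Z.2 hZ).2) ?_
  rintro Z ⟨g, -, hX, hY⟩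
  replace hX : D Z.1 = g := hX
  replace hY : D Z.2 = J g := hY
  cases p with
  | zero => exact fun _ i => i.elim0
  | succ p =>
    refine update_add_I_mul_update _ Z.1 Z.2 fun w => ?_
    have key := cons_add_I_mul_cons_of_oneWedge (w := fun i => D (w i))
      (hX ▸ hαD Z.1) (hY ▸ hαD Z.2) hv (h g) (fun i => hαD (w i))
    have hc : ∀ X : E, (β.compContinuousLinearMap D).toAlternatingMap (Fin.cons X w) =
        β (Fin.cons (D X) fun i => D (w i)) := by
      intro X
      refine congrArg β ?_
      funext i
      exact Fin.cases rfl (fun i => rfl) i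
    rw [hc, hc, hX, hY, key]

end Algebra

/-! ### CR manifolds: the residue form and its CR property. -/

namespace CRStructure

section
variable {n k : ℕ} {M : Type*} [TopologicalSpace M]
  [ChartedSpace (RModel (2 * n + k)) M] [IsManifold 𝓘(ℝ, RModel (2 * n + k)) ∞ M]

/-- Every vector of the Levi distribution is the value of a smooth local section whose image
under `J` is smooth. -/
theorem exists_smooth_section (cr : CRStructure n k M) {x : M} (h : cr.H x) :
    ∃ (W : Set M) (A : ∀ x : M, cr.H x), IsOpen W ∧ x ∈ W ∧ A x = h ∧
      SmoothFieldOn (fun x => (A x : TangentSpace 𝓘(ℝ, RModel (2 * n + k)) x)) W ∧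
      SmoothFieldOn (fun x => (cr.J x (A x) : TangentSpace 𝓘(ℝ, RModel (2 * n + k)) x)) W := by
  obtain ⟨W, hW, hx, X, hX, hX1, hX2⟩ := cr.smooth x
  have hh : h ∈ Submodule.span ℝ (range fun i => X i x) := by rw [hX x hx]; trivial
  obtain ⟨c, hc⟩ := (Submodule.mem_span_range_iff_exists_fun ℝ).1 hh
  have : IsManifold 𝓘(ℝ, RModel (2 * n + k)) 1 M := .of_le (n := ∞) (by simp)
  -- A combination of the local frame with constant coefficients stays smooth after applying `J`, as
  -- `J` maps the frame to smooth fields.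
  refine ⟨W, fun x => ∑ i, c i • X i x, hW, hx, hc, ?_, ?_⟩
  · have := ContMDiffOn.sum_section (s := Finset.univ)
      fun i _ => ContMDiffOn.const_smul_section (a := c i) (hX1 i)
    refine ContMDiffOn.congr this fun x _ => ?_
    congr 1
    push_cast
    rfl
  · have := ContMDiffOn.sum_section (s := Finset.univ)
      fun i _ => ContMDiffOn.const_smul_section (a := c i) (hX2 i)
    refine ContMDiffOn.congr this fun x _ => ?_
    congr 1
    beta_reduce
    rw [map_sum]
    push_cast
    simp only [map_smul]
    rfl

end

section
variable {n k : ℕ} {M N : Type*} [TopologicalSpace M]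
  [ChartedSpace (RModel (2 * (n + 1) + k)) M] [IsManifold 𝓘(ℝ, RModel (2 * (n + 1) + k)) ∞ M]
  [TopologicalSpace N] [ChartedSpace (RModel (2 * n + k)) N]

theorem inducedH_le_H (cr : CRStructure (n + 1) k M) (ι : N → M) (y : N) :
    cr.inducedH ι y ≤ cr.H (ι y) := by
  rintro _ ⟨h, _, rfl⟩
  exact h.2

theorem inducedH_le_tangentImage (cr : CRStructure (n + 1) k M) (ι : N → M) (y : N) :
    cr.inducedH ι y ≤ tangentImage ι y := by
  rintro _ ⟨h, hh, rfl⟩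
  exact hh.1

/-- `J² = -1` makes `J` exchange the two subspaces whose intersection defines `HS`. -/
theorem J_mem_inducedH (cr : CRStructure (n + 1) k M) (ι : N → M) (y : N) (h : cr.H (ι y))
    (hh : (h : TangentSpace 𝓘(ℝ, RModel (2 * (n + 1) + k)) (ι y)) ∈ cr.inducedH ι y) :
    (cr.J (ι y) h : TangentSpace 𝓘(ℝ, RModel (2 * (n + 1) + k)) (ι y)) ∈ cr.inducedH ι y := by
  obtain ⟨h', ⟨h1, h2⟩, he⟩ := hh
  obtain rfl : h' = h := Subtype.ext he
  refine ⟨cr.J (ι y) h', ⟨?_, h', h1, rfl⟩, rfl⟩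
  obtain ⟨g, hg, rfl⟩ := h2
  rw [cr.J_sq]
  exact neg_mem hg

variable [IsManifold 𝓘(ℝ, RModel (2 * n + k)) ∞ N]
  {p : ℕ} {φ θ : DForm (2 * (n + 1) + k) M (p + 1)} {ψ : DForm (2 * (n + 1) + k) M p}
  {ι : N → M} {U : Set M} {s : M → ℂ}

theorem IsPoleChart.isDefiningFunction {cr : CRStructure (n + 1) k M}
    (h : cr.IsPoleChart ι φ U s) :
    IsDefiningFunction (2 * (n + 1) + k) (range ι) U s where
  isOpen := h.isOpen
  contMDiffAt _ hx := h.smooth.contMDiffAt (h.isOpen.mem_nhds hx)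
  zero_iff := h.zero_iff
  differential_ne_zero := h.differential_ne_zero

/-- Extend `h` to a local section `A` of `HM`. Off `S` the form `φ` annihilates `A + iJA`, and the
limit gives the claim at `ι y`, for all of `H` and not only for directions tangent to `S`. -/
theorem dfunWedge_annihilates (cr : CRStructure (n + 1) k M)
    (hs : IsDefiningFunction (2 * (n + 1) + k) (range ι) U s)
    (hdec : IsDecomposition ι φ U s ψ θ)
    (hφ : ∀ x ∈ (range ι)ᶜ, (φ x).toAlternatingMap ∈ idealPow (cr.T01 x) (p + 1) (p + 1))
    {y : N} (hy : ι y ∈ U) (h : cr.H (ι y)) (w : Fin p → RModel (2 * (n + 1) + k)) :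
    oneWedge (modelDfun s (ι y)) (ψ (ι y)) (Fin.cons (h.1 : RModel (2 * (n + 1) + k)) w) +
      Complex.I * oneWedge (modelDfun s (ι y)) (ψ (ι y))
        (Fin.cons ((cr.J (ι y) h).1 : RModel (2 * (n + 1) + k)) w) = 0 := by
  obtain ⟨W, A, hW, hyW, rfl, hA, hB⟩ := cr.exists_smooth_section h
  refine hs.dfunWedge_cons_eq_zero hdec.1 hdec.2.1 hdec.2.2 hy (mem_range_self y) hW hyW hA hB
    (fun x' hx' w => ?_) w
  exact cons_add_I_mul_cons_of_mem_idealPow (hφ x' hx'.2) ⟨A x', rfl⟩ w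

theorem pullback_mem_idealPow (cr : CRStructure (n + 1) k M)
    (hι : IsSmoothEmbedding 𝓘(ℝ, RModel (2 * n + k)) 𝓘(ℝ, RModel (2 * (n + 1) + k)) ∞ ι)
    (hs : IsDefiningFunction (2 * (n + 1) + k) (range ι) U s)
    (hdec : IsDecomposition ι φ U s ψ θ)
    (hφ : ∀ x ∈ (range ι)ᶜ, (φ x).toAlternatingMap ∈ idealPow (cr.T01 x) (p + 1) (p + 1))
    {y : N} (hy : ι y ∈ U) :
    ((DForm.pullback ι ψ : DForm (2 * n + k) N p) y).toAlternatingMap ∈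
      idealPow (cr.inducedT01 ι y) p p := by
  obtain ⟨v, hv⟩ := DFunLike.ne_iff.1 (hs.differential_ne_zero _ hy)
  exact comp_mem_idealPow_of_oneWedge (E := RModel (2 * n + k)) (F := RModel (2 * (n + 1) + k))
    (D := modelDeriv ι y) (α := modelDfun s (ι y)) (β := ψ (ι y)) (modelDeriv_injective hι y) hv
    (hs.modelDfun_comp hι.contMDiff hy) (cr.J_sq (ι y)) (cr.inducedH_le_H ι y)
    (cr.inducedH_le_tangentImage ι y) (cr.J_mem_inducedH ι y)
    (cr.dfunWedge_annihilates hs hdec hφ hy)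

theorem IsPoleChart.exists_decomposition [T2Space M] [SigmaCompactSpace M]
    {cr : CRStructure (n + 1) k M} (h : cr.IsPoleChart ι φ U s) (hS : IsClosed (range ι))
    (hφ : φ.SmoothOn (range ι)ᶜ) (hdφ : ∀ x ∈ (range ι)ᶜ, φ.d x = 0) :
    ∃ ψ θ, IsDecomposition ι φ U s ψ θ := by
  obtain ⟨η, hη, hηφ⟩ := h.smooth_extension
  exact _root_.exists_decomposition h.isOpen hS h.smooth
    (fun x hx h0 => hx.2 ((h.zero_iff x hx.1).1 h0)) h.differential_ne_zero hη hηφ hφ hdφ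

theorem IsPoleChart.d_pullback_eq_zero {cr : CRStructure (n + 1) k M} (hι : cr.IsPolar ι)
    (h : cr.IsPoleChart ι φ U s) (hφ : φ.SmoothOn (range ι)ᶜ)
    (hdφ : ∀ x ∈ (range ι)ᶜ, φ.d x = 0) (hdec : IsDecomposition ι φ U s ψ θ) {y : N}
    (hy : ι y ∈ U) : (DForm.pullback ι ψ : DForm (2 * n + k) N p).d y = 0 :=
  h.isDefiningFunction.d_pullback_eq_zero hι.embedding.contMDiff hι.closed hφ hdφ hdec.1
    hdec.2.1 hdec.2.2 hy

theorem IsPoleChart.pullback_eq {cr : CRStructure (n + 1) k M} (hι : cr.IsPolar ι)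
    (h : cr.IsPoleChart ι φ U s) (hdec : IsDecomposition ι φ U s ψ θ)
    {U' : Set M} {s' : M → ℂ} {θ' : DForm (2 * (n + 1) + k) M (p + 1)}
    {ψ' : DForm (2 * (n + 1) + k) M p} (h' : cr.IsPoleChart ι φ U' s')
    (hdec' : IsDecomposition ι φ U' s' ψ' θ') {y : N} (hy : ι y ∈ U) (hy' : ι y ∈ U') :
    (DForm.pullback ι ψ : DForm (2 * n + k) N p) y = DForm.pullback ι ψ' y :=
  h.isDefiningFunction.pullback_eq hι.embedding.contMDiff hdec.1 hdec.2.1 hdec.2.2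
    h'.isDefiningFunction hdec'.1 hdec'.2.1 hdec'.2.2 hy hy'

/-- Only membership in `I^p` needs the CR hypothesis; the condition on the exterior derivative holds
because the restriction is closed. -/
theorem IsPoleChart.isCRFormOn_pullback {cr : CRStructure (n + 1) k M} (hι : cr.IsPolar ι)
    (h : cr.IsPoleChart ι φ U s) (hφ : φ.SmoothOn (range ι)ᶜ)
    (hdφ : ∀ x ∈ (range ι)ᶜ, φ.d x = 0) (hdec : IsDecomposition ι φ U s ψ θ)
    (hcr : IsCRFormOn cr.T01 φ (range ι)ᶜ) :
    IsCRFormOn (cr.inducedT01 ι) (DForm.pullback ι ψ : DForm (2 * n + k) N p) (ι ⁻¹' U) := by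
  refine ⟨DForm.SmoothOn.pullback hι.embedding.contMDiff h.isOpen hdec.1, fun y hy => ⟨?_, ?_⟩⟩
  · exact cr.pullback_mem_idealPow hι.embedding h.isDefiningFunction hdec
      (fun x hx => (hcr.2 x hx).1) hy
  · rw [h.d_pullback_eq_zero hι hφ hdφ hdec hy]
    exact zero_mem _

/-- At each `y` the value is read off from one chosen pole chart around `ι y`. Independence of
choices makes it agree with all the others, and these charts cover `S`, which forces uniqueness. -/
theorem existsUnique_isResidueForm [T2Space M] [SigmaCompactSpace M]
    {cr : CRStructure (n + 1) k M} (hι : cr.IsPolar ι) (hφ : φ.SmoothOn (range ι)ᶜ)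
    (hdφ : ∀ x ∈ (range ι)ᶜ, φ.d x = 0) (hpole : cr.HasFirstOrderPole ι φ) :
    ∃! r : DForm (2 * n + k) N p, cr.IsResidueForm ι φ r := by
  choose V s hV hs using hpole
  choose ψ θ hdec using fun y => (hs y).exists_decomposition hι.closed hφ hdφ
  refine ⟨fun y => DForm.pullback ι (ψ y) y, fun U s' ψ' θ' h' hdec' y hy => ?_, fun r hr => ?_⟩
  · exact (hs y).pullback_eq hι (hdec y) h' hdec' (hV y) hy
  · funext y
    exact hr _ _ _ _ (hs y) (hdec y) y (hV y)

/-- The residue form is locally the pullback of `ψ`. -/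
theorem IsResidueForm.properties [T2Space M] [SigmaCompactSpace M]
    {cr : CRStructure (n + 1) k M} (hι : cr.IsPolar ι) (hφ : φ.SmoothOn (range ι)ᶜ)
    (hdφ : ∀ x ∈ (range ι)ᶜ, φ.d x = 0) (hpole : cr.HasFirstOrderPole ι φ)
    {r : DForm (2 * n + k) N p} (hr : cr.IsResidueForm ι φ r) :
    r.SmoothOn univ ∧ (∀ y, r.d y = 0) ∧
      (IsCRFormOn cr.T01 φ (range ι)ᶜ → IsCRFormOn (cr.inducedT01 ι) r univ) := by
  choose V s hV hs using hpole
  choose ψ θ hdec using fun y => (hs y).exists_decomposition hι.closed hφ hdφ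
  have hop : ∀ y, IsOpen (ι ⁻¹' V y) :=
    fun y => (hs y).isOpen.preimage hι.embedding.contMDiff.continuous
  -- The charts chosen at neighbouring points differ, but near `y` the form equals the pullback of
  -- the single form `ψ y`, so local properties carry over.
  have hev : ∀ y, ∀ᶠ y' in 𝓝 y, r y' = DForm.pullback ι (ψ y) y' := fun y => by
    filter_upwards [(hop y).mem_nhds (hV y)] with y' hy'
    exact hr _ _ _ _ (hs y) (hdec y) y' hy'
  have hsm : r.SmoothOn univ := by
    refine (DForm.smoothOn_iff isOpen_univ).2 fun y _ => ?_
    have h := DForm.SmoothOn.pullback hι.embedding.contMDiff (hs y).isOpen (hdec y).1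
    exact ((DForm.smoothOn_iff (hop y)).1 h y (hV y)).congr (hev y)
  have hd : ∀ y, r.d y = 0 := fun y =>
    (DForm.d_congr (hev y)).trans ((hs y).d_pullback_eq_zero hι hφ hdφ (hdec y) (hV y))
  refine ⟨hsm, hd, fun hcr => ⟨hsm, fun y _ => ⟨?_, ?_⟩⟩⟩
  · rw [(hev y).self_of_nhds]
    exact (((hs y).isCRFormOn_pullback hι hφ hdφ (hdec y) hcr).2 y (hV y)).1
  · rw [hd y]
    exact zero_mem _

end

end CRStructure

end

/-! ### The residue theorem. -/

theorem theorem4p1 {n k : ℕ} {M N : Type*}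
    [TopologicalSpace M] [T2Space M] [SigmaCompactSpace M]
    [ChartedSpace (RModel (2 * (n + 1) + k)) M] [IsManifold 𝓘(ℝ, RModel (2 * (n + 1) + k)) ∞ M]
    [TopologicalSpace N] [ChartedSpace (RModel (2 * n + k)) N]
    [IsManifold 𝓘(ℝ, RModel (2 * n + k)) ∞ N]
    (cr : CRStructure (n + 1) k M) (ι : N → M) (hS : cr.IsPolar ι) :
    -- forms of positive degree
    (∀ (p : ℕ) (φ : DForm (2 * (n + 1) + k) M (p + 1)),
      φ.SmoothOn (range ι)ᶜ → (∀ x ∈ (range ι)ᶜ, φ.d x = 0) → cr.HasFirstOrderPole ι φ →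
      -- existence of the local decomposition
      (∀ U s, cr.IsPoleChart ι φ U s → ∃ ψ θ, CRStructure.IsDecomposition ι φ U s ψ θ) ∧
      -- the restriction of `ψ` to `S` is a smooth closed form on `S ∩ U`
      (∀ U s ψ θ, cr.IsPoleChart ι φ U s → CRStructure.IsDecomposition ι φ U s ψ θ →
        (DForm.pullback ι ψ : DForm (2 * n + k) N p).SmoothOn (ι ⁻¹' U) ∧
        ∀ y ∈ ι ⁻¹' U, (DForm.pullback ι ψ : DForm (2 * n + k) N p).d y = 0) ∧
      -- and does not depend on the choice of the defining function and of the decomposition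
      (∀ U s ψ θ U' s' ψ' θ', cr.IsPoleChart ι φ U s → CRStructure.IsDecomposition ι φ U s ψ θ →
        cr.IsPoleChart ι φ U' s' → CRStructure.IsDecomposition ι φ U' s' ψ' θ' →
        ∀ y ∈ ι ⁻¹' (U ∩ U'),
          (DForm.pullback ι ψ : DForm (2 * n + k) N p) y = DForm.pullback ι ψ' y) ∧
      -- if `φ` is a CR form, then so is the restriction of `ψ` to `S`
      (IsCRFormOn cr.T01 φ (range ι)ᶜ →
        ∀ U s ψ θ, cr.IsPoleChart ι φ U s → CRStructure.IsDecomposition ι φ U s ψ θ →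
        IsCRFormOn (cr.inducedT01 ι) (DForm.pullback ι ψ : DForm (2 * n + k) N p) (ι ⁻¹' U)) ∧
      -- the global residue form
      (∃! r : DForm (2 * n + k) N p, cr.IsResidueForm ι φ r) ∧
      (∀ r : DForm (2 * n + k) N p, cr.IsResidueForm ι φ r →
        r.SmoothOn univ ∧ (∀ y, r.d y = 0) ∧
        (IsCRFormOn cr.T01 φ (range ι)ᶜ → IsCRFormOn (cr.inducedT01 ι) r univ))) ∧
    -- forms of degree zero, where `ψ = 0`
    (∀ φ : DForm (2 * (n + 1) + k) M 0,
      φ.SmoothOn (range ι)ᶜ → (∀ x ∈ (range ι)ᶜ, φ.d x = 0) → cr.HasFirstOrderPole ι φ →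
      ∀ U s, cr.IsPoleChart ι φ U s →
        ∃ θ : DForm (2 * (n + 1) + k) M 0, θ.SmoothOn U ∧ ∀ x ∈ U \ range ι, φ x = θ x) := by
  refine ⟨fun p φ hφ hdφ hpole => ⟨fun U s h => h.exists_decomposition hS.closed hφ hdφ,
    fun U s ψ θ h hdec => ⟨?_, fun y hy => h.d_pullback_eq_zero hS hφ hdφ hdec hy⟩,
    fun U s ψ θ U' s' ψ' θ' h hdec h' hdec' y hy => h.pullback_eq hS hdec h' hdec' hy.1 hy.2,
    fun hcr U s ψ θ h hdec => h.isCRFormOn_pullback hS hφ hdφ hdec hcr,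
    CRStructure.existsUnique_isResidueForm hS hφ hdφ hpole,
    fun r hr => hr.properties hS hφ hdφ hpole⟩, fun φ hφ hdφ _ U s h => ?_⟩
  · exact DForm.SmoothOn.pullback hS.embedding.contMDiff h.isOpen hdec.1
  · obtain ⟨η, hη, hηφ⟩ := h.smooth_extension
    exact exists_extension h.isOpen hS.closed h.smooth h.differential_ne_zero hη hηφ hφ hdφ
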